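/- **Theorem.** Let $T>0$, let $(\Omega,\mathcal F,\mathbb P)$ be a probability space, and let $\alpha,\gamma>0$ with $\alpha+\gamma>1$. Let $Z=(Z_t)_{t\in[0,T]}\in BV_iC^{\alpha}$. This means that, almost surely, $Z_t=g(X_t)$ for all $t\in[0,T]$, where $g:\mathbb R\to\mathbb R$ is of bounded variation on every compact interval and $X=(X_t)_{t\in[0,T]}$ is a real stochastic process with the following two properties: almost every path of $X$ is Hölder continuous of order $\alpha$ on $[0,T]$ (with a constant that may depend on $\omega$); and there is $h\in L^1([0,T])$ such that for almost every $t\in[0,T]$ the random variable $X_t$ has a Lebesgue density $p_t$ with $\sup_{y} p_t(y)\le h(t)$ (densities being taken up to null sets). Let $Y=(Y_t)_{t\in[0,T]}$ be a real stochastic process almost every path of which is Hölder continuous of order $\gamma$ on $[0,T]$. For $\beta\in(0,1)$ let $W_1^{\beta}$ and $W_2^\beta$ be the spaces of measurable $f:[0,T]\to\mathbb R$ with, respectively, $$\sup_{0\le s<t\le T}\left(\frac{|f(t)-f(s)|}{(t-s)^\beta}+\int_s^t\frac{|f(u)-f(s)|}{(u-s)^{1+\beta}}\,du\right)<\infty,$$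 $$\int_0^T\frac{|f(s)|}{s^\beta}\,ds+\int_0^T\int_0^s\frac{|f(u)-f(s)|}{(s-u)^{1+\beta}}\,du\,ds<\infty .$$ Put $$D^{\beta}_{0+}f(s)=\frac1{\Gamma(1-\beta)}\left(\frac{f(s)}{s^\beta}+\beta\int_0^s\frac{f(s)-f(u)}{(s-u)^{\beta+1}}\,du\right),$$ $$D^{\beta}_{T-}f(s)=\frac1{\Gamma(1-\beta)}\left(\frac{f(s)}{(T-s)^\beta}+\beta\int_s^T\frac{f(s)-f(u)}{(u-s)^{\beta+1}}\,du\right).$$ The generalized Lebesgue–Stieltjes integral of $f$ with respect to $g$ exists and equals $I$ if there is some $\beta\in(0,1)$ with $f\in W_2^\beta$ and $g\in W_1^{1-\beta}$, and if for every such $\beta$ the following integral converges absolutely and has the value $I$: $$\int_0^T f\,dg=-\int_0^T D^\beta_{0+}f(s)\; D^{1-\beta}_{T-}\bigl(g-g(T-)\bigr)(s)\,ds .$$ Then for every sequence of partitions $\pi_n=\{0=t^n_0<t^n_1<\dots<t^n_{k(n)}=T\}$ with $\max_i|t^n_i-t^n_{i-1}|\to0$ and every choice of tags $\xi^n_i\in[t^n_{i-1},t^n_i]$,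 almost surely the generalized Lebesgue–Stieltjes integral $\int_0^T Z_s\,dY_s$ exists and $$\sum_{i=1}^{k(n)}Z_{\xi^n_i}\bigl(Y_{t^n_i}-Y_{t^n_{i-1}}\bigr)\longrightarrow\int_0^T Z_s\,dY_s\qquad(n\to\infty).$$ -/

import Mathlib

open MeasureTheory ProbabilityTheory Set Filter Topology
open scoped NNReal ENNReal

noncomputable section

/-! Functions on `[0, T]` and processes indexed by `[0, T]` are represented by functions on `ℝ`;
only their values on `[0, T]` are ever used. -/

/-- The fractional Besov space `W₁^β([0,T])`: measurable functions on `[0,T]` with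
`sup_{0 ≤ s < t ≤ T} (|f t - f s| / (t-s)^β + ∫_s^t |f u - f s| / (u-s)^(1+β) du) < ∞`. -/
def MemBesovOne (β T : ℝ) (f : ℝ → ℝ) : Prop :=
  Measurable ((Icc 0 T).domRestrict f) ∧
    (⨆ (s : ℝ) (t : ℝ) (_ : 0 ≤ s ∧ s < t ∧ t ≤ T),
      (ENNReal.ofReal (|f t - f s| / (t - s) ^ β) +
        ∫⁻ u in Ioc s t, ENNReal.ofReal (|f u - f s| / (u - s) ^ (1 + β)))) < ∞

/-- The fractional Besov space `W₂^β([0,T])`: measurable functions on `[0,T]` with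
`∫_0^T |f s| / s^β ds + ∫_0^T ∫_0^s |f u - f s| / (s-u)^(1+β) du ds < ∞`. -/
def MemBesovTwo (β T : ℝ) (f : ℝ → ℝ) : Prop :=
  Measurable ((Icc 0 T).domRestrict f) ∧
    (∫⁻ s in Ioc 0 T, ENNReal.ofReal (|f s| / s ^ β)) +
      (∫⁻ s in Ioc 0 T, ∫⁻ u in Ioc 0 s,
        ENNReal.ofReal (|f u - f s| / (s - u) ^ (1 + β))) < ∞

/-- The left-sided Riemann–Liouville (Weyl) fractional derivative `D^β_{0+} f`. -/
def fracDerivLeft (β : ℝ) (f : ℝ → ℝ) (s : ℝ) : ℝ :=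
  1 / Real.Gamma (1 - β) *
    (f s / s ^ β + β * ∫ u in (0 : ℝ)..s, (f s - f u) / (s - u) ^ (β + 1))

/-- The right-sided Riemann–Liouville (Weyl) fractional derivative `D^β_{t-} f`, without the
customary formal factor `(-1)^β`. -/
def fracDerivRight (β t : ℝ) (f : ℝ → ℝ) (s : ℝ) : ℝ :=
  1 / Real.Gamma (1 - β) *
    (f s / (t - s) ^ β + β * ∫ u in s..t, (f s - f u) / (u - s) ^ (β + 1))

/-- The integrand `(-1)^β (D^β_{0+} f)(s) (D^{1-β}_{t-} g_{t-})(s)` of the generalized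
Lebesgue–Stieltjes integral over `[0,t]`, where `g_{t-}(s) = g(s) - g(t-)`.
The two formal factors combine to the real sign `(-1)^β (-1)^(1-β) = -1`. -/
def glsIntegrand (β t : ℝ) (f g : ℝ → ℝ) (s : ℝ) : ℝ :=
  -(fracDerivLeft β f s * fracDerivRight (1 - β) t (fun r => g r - Function.leftLim g t) s)

/-- The orders `β ∈ (0,1)` which may be used to compute `∫_0^T f dg`. -/
def GLSAdmissible (β T : ℝ) (f g : ℝ → ℝ) : Prop :=
  0 < β ∧ β < 1 ∧ MemBesovTwo β T f ∧ MemBesovOne (1 - β) T g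

/-- The generalized Lebesgue–Stieltjes integral `∫_0^T f dg` exists and equals `I`:
some order `β` is admissible, and for every admissible `β` the defining Lebesgue integral
converges absolutely and has the value `I`. -/
def HasGLSIntegral (T : ℝ) (f g : ℝ → ℝ) (I : ℝ) : Prop :=
  (∃ β, GLSAdmissible β T f g) ∧
    ∀ β, GLSAdmissible β T f g →
      IntervalIntegrable (glsIntegrand β T f g) volume 0 T ∧
        ∫ s in (0 : ℝ)..T, glsIntegrand β T f g s = I

/-- `X ∈ C^α([0,T])`: a stochastic process almost all of whose paths are Hölder continuous
of order `α` on `[0,T]` (with a random Hölder constant). -/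
def IsHolderProcess {Ω : Type*} [MeasurableSpace Ω] (P : Measure Ω) (T : ℝ) (α : ℝ≥0)
    (X : ℝ → Ω → ℝ) : Prop :=
  (∀ t ∈ Icc 0 T, AEMeasurable (X t) P) ∧
    ∀ᵐ ω ∂P, ∃ C : ℝ≥0, HolderOnWith C α (fun t => X t ω) (Icc 0 T)

/-- For almost every `t ∈ [0,T]` the variable `X t` has a density `p_t`, and there is
`h ∈ L¹([0,T])` with `sup_y p_t(y) ≤ h t`. Densities are determined up to null sets, so the
supremum is the essential one. -/
def HasIntegrablyBoundedDensity {Ω : Type*} [MeasurableSpace Ω] (P : Measure Ω) (T : ℝ)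
    (X : ℝ → Ω → ℝ) : Prop :=
  ∃ h : ℝ → ℝ, IntegrableOn h (Icc 0 T) ∧
    ∀ᵐ t ∂(volume.restrict (Icc 0 T)),
      HasPDF (X t) P volume ∧ ∀ᵐ y : ℝ, pdf (X t) P volume y ≤ ENNReal.ofReal (h t)

/-- `Z ∈ BV_iC^α`: up to indistinguishability `Z = g(X)` on `[0,T]`, where `g : ℝ → ℝ` has locally
bounded variation and `X ∈ C^α([0,T])` has densities with an integrable bound. -/
def MemBViC {Ω : Type*} [MeasurableSpace Ω] (P : Measure Ω) (T : ℝ) (α : ℝ≥0)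
    (Z : ℝ → Ω → ℝ) : Prop :=
  ∃ (g : ℝ → ℝ) (X : ℝ → Ω → ℝ),
    LocallyBoundedVariationOn g univ ∧ IsHolderProcess P T α X ∧
      HasIntegrablyBoundedDensity P T X ∧
        ∀ᵐ ω ∂P, ∀ t ∈ Icc 0 T, Z t ω = g (X t ω)

/-- A partition `0 = t_0 < ⋯ < t_k = T` of `[0,T]`, with a tag in each closed cell. -/
structure TaggedPartition (T : ℝ) where
  k : ℕ
  pt : Fin (k + 1) → ℝ
  strictMono_pt : StrictMono pt
  pt_zero : pt 0 = 0
  pt_last : pt (Fin.last k) = T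
  tag : Fin k → ℝ
  tag_mem : ∀ i : Fin k, tag i ∈ Icc (pt i.castSucc) (pt i.succ)

/-- The mesh `max_i (t_i - t_{i-1})`. -/
def TaggedPartition.mesh {T : ℝ} (π : TaggedPartition T) : ℝ :=
  ⨆ i : Fin π.k, (π.pt i.succ - π.pt i.castSucc)

/-- The Riemann–Stieltjes sum `∑_i f(tag_i) (g(t_i) - g(t_{i-1}))`. -/
def TaggedPartition.rsSum {T : ℝ} (π : TaggedPartition T) (f g : ℝ → ℝ) : ℝ :=
  ∑ i : Fin π.k, f (π.tag i) * (g (π.pt i.succ) - g (π.pt i.castSucc))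

end

/-! The argument is pathwise once one random quantity is known to be finite. Write `g` as a
difference of monotone functions and let ν be the Stieltjes measure of their sum, restricted to a
compact interval containing the range of the path. Then |Z_s - Z_t| is at most the ν-mass of the
closed interval between X_s and X_t, which lies in the ball of radius C|s-t|^α about X_s.
Integrating this bound against |s-t|^(-1-p) and exchanging the integrals turns the fractional
increments of Z at time s into the Riesz potential ∫ |X_s - b|^(-p/α) ν(db). The density bound makes
the expected time integral of this potential finite as soon as p < α
(`HasIntegrablyBoundedDensity.ae_energy_lt_top`). Since α + γ > 1, some p satisfies 1 - γ < p <
min(1, α); for it Z lies in W₂^p and Y in W₁^(1-p).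

The integral must not depend on the order. Extending f by zero outside (0, T] and Y - Y_T by zero
after T turns the two fractional derivatives into multiples of Marchaud derivatives, which commute
with moving averages. Averaging the integrator twice makes it a second primitive of a bounded
function w: one primitive is used up by each of the two derivatives, and the fractional integrals of
orders p and 1 - p that are left compose to a constant times an ordinary primitive. The pairing is
thus a limit of ordinary integrals of f against the derivative of the averaged integrator, in which
p no longer appears (`IsMarchaudLeft.tendsto_integral_mul_weylInt`,
`GLSAdmissible.tendsto_forwardIntegral`).

The same approximation is linear in f and gives the plain increment of the integrator when f is the
indicator of a cell. Splitting f on each cell into its value at the tag and a deviation therefore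
expresses the error of a Riemann–Stieltjes sum through the deviations, and bounds it by their
Marchaud norms (`TaggedPartition.exists_abs_integral_sub_rsSum_le`). On a cell of length δ that norm
is controlled by the time integral over the cell of the potential of ν restricted to the ball of
radius Cδ^α about the path (`IsHolderDominated.marchaudNorm_indicator_le`). These bounds add up over
the cells, and finite energy sends the total to zero with the mesh
(`tendsto_lintegral_localPotential`). -/

/-! ### Fractional integrals of bounded functions on the half-line -/

/-- The unnormalised right-sided Riemann–Liouville integral of order `1 - p`. -/
noncomputable def weylInt (p : ℝ) (w : ℝ → ℝ) (s : ℝ) : ℝ := ∫ x in Ioi (0 : ℝ), w (s + x) * x ^ (-p)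

/-- The unnormalised right-sided Marchaud derivative on the half-line. -/
noncomputable def marchaudRight (p : ℝ) (h : ℝ → ℝ) (s : ℝ) : ℝ :=
  ∫ q in Ioi (0 : ℝ), (h s - h (s + q)) * q ^ (-1 - p)

/-- The unnormalised left-sided Marchaud derivative on the line. -/
noncomputable def marchaudLeft (p : ℝ) (f : ℝ → ℝ) (s : ℝ) : ℝ :=
  ∫ r in Ioi (0 : ℝ), (f s - f (s - r)) * r ^ (-1 - p)

/-- Measurable functions bounded by `B` on the half-line `[0, ∞)` and vanishing after `T`. -/
structure IsTame (T B : ℝ) (w : ℝ → ℝ) : Prop where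
  measurable : Measurable w
  abs_le : ∀ s, 0 ≤ s → |w s| ≤ B
  eq_zero : ∀ s, T < s → w s = 0

theorem integrable_indicator_Ioc_rpow_neg (T : ℝ) {p : ℝ} (hp : p < 1) :
    Integrable ((Ioc 0 T).indicator fun x : ℝ => x ^ (-p)) := by
  rcases le_or_gt 0 T with hT | hT
  · rw [integrable_indicator_iff measurableSet_Ioc,
      ← intervalIntegrable_iff_integrableOn_Ioc_of_le hT]
    exact intervalIntegral.intervalIntegrable_rpow' (by linarith)
  · simp [Ioc_eq_empty hT.not_gt]

theorem indicator_Ioc_rpow_nonneg (T p x : ℝ) :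
    0 ≤ (Ioc 0 T).indicator (fun x : ℝ => x ^ p) x :=
  indicator_nonneg (fun y (hy : y ∈ Ioc 0 T) => Real.rpow_nonneg hy.1.le p) x

namespace IsTame

variable {T B : ℝ} {w : ℝ → ℝ}

theorem bound_nonneg (hw : IsTame T B w) : 0 ≤ B := (abs_nonneg _).trans (hw.abs_le 0 le_rfl)

/-- For s ≥ 0 a lag x > T lands beyond T, where w vanishes. The dominating function is thus free of
s, which makes all later bounds uniform. -/
theorem abs_le_indicator (hw : IsTame T B w) {s x : ℝ} (hs : 0 ≤ s) (hx : 0 < x) (p : ℝ) :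
    |w (s + x) * x ^ p| ≤ B * (Ioc 0 T).indicator (fun x => x ^ p) x := by
  rw [abs_mul, abs_of_nonneg (Real.rpow_nonneg hx.le _)]
  by_cases hxT : x ≤ T
  · rw [indicator_of_mem (show x ∈ Ioc 0 T from ⟨hx, hxT⟩)]
    exact mul_le_mul_of_nonneg_right (hw.abs_le _ (by linarith)) (Real.rpow_nonneg hx.le _)
  · rw [hw.eq_zero _ (by linarith), abs_zero, zero_mul]
    exact mul_nonneg hw.bound_nonneg (indicator_Ioc_rpow_nonneg _ _ _)

theorem integrableOn_mul_rpow (hw : IsTame T B w) {s p : ℝ} (hs : 0 ≤ s) (hp : p < 1) :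
    IntegrableOn (fun x => w (s + x) * x ^ (-p)) (Ioi 0) := by
  refine Integrable.mono' ((integrable_indicator_Ioc_rpow_neg T hp).const_mul B).integrableOn
    (by have := hw.measurable; fun_prop) ?_
  filter_upwards [ae_restrict_mem measurableSet_Ioi] with x hx
  exact hw.abs_le_indicator hs hx _

theorem integrableOn (hw : IsTame T B w) {s : ℝ} (hs : 0 ≤ s) :
    IntegrableOn (fun x => w (s + x)) (Ioi 0) := by
  simpa using hw.integrableOn_mul_rpow (p := 0) hs one_pos

theorem weylInt (hw : IsTame T B w) {p : ℝ} (hp : p < 1) :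
    IsTame T (B * ∫ x, (Ioc 0 T).indicator (fun x : ℝ => x ^ (-p)) x) (weylInt p w) where
  measurable := by
    have : Measurable (fun z : ℝ × ℝ => w (z.1 + z.2) * z.2 ^ (-p)) := by
      have := hw.measurable; fun_prop
    exact (this.stronglyMeasurable.integral_prod_right
      (ν := volume.restrict (Ioi 0))).measurable
  abs_le s hs := by
    rw [_root_.weylInt, ← Real.norm_eq_abs, ← integral_const_mul]
    refine (norm_integral_le_of_norm_le
      ((integrable_indicator_Ioc_rpow_neg T hp).const_mul B).integrableOn ?_).trans ?_
    · filter_upwards [ae_restrict_mem measurableSet_Ioi] with x hx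
      exact hw.abs_le_indicator hs hx _
    · refine setIntegral_le_integral ((integrable_indicator_Ioc_rpow_neg T hp).const_mul B) ?_
      exact ae_of_all _ fun x => mul_nonneg hw.bound_nonneg (indicator_Ioc_rpow_nonneg _ _ _)
  eq_zero s hs := by
    rw [_root_.weylInt]
    refine (setIntegral_congr_fun measurableSet_Ioi fun x hx => ?_).trans (integral_zero _ _)
    simp [hw.eq_zero (s + x) (by linarith [mem_Ioi.1 hx])]

theorem const_mul (hw : IsTame T B w) (c : ℝ) : IsTame T (|c| * B) (fun s => c * w s) where
  measurable := hw.measurable.const_mul c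
  abs_le s hs := by
    rw [abs_mul]; exact mul_le_mul_of_nonneg_left (hw.abs_le s hs) (abs_nonneg _)
  eq_zero s hs := by rw [hw.eq_zero s hs, mul_zero]

theorem sub_comp_add (hw : IsTame T B w) {ε : ℝ} (hε : 0 ≤ ε) :
    IsTame T (B + B) (fun s => w s - w (s + ε)) where
  measurable := by have := hw.measurable; fun_prop
  abs_le s hs := (abs_sub _ _).trans (add_le_add (hw.abs_le s hs) (hw.abs_le _ (by linarith)))
  eq_zero s hs := by rw [hw.eq_zero s hs, hw.eq_zero _ (by linarith), sub_zero]

end IsTame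

theorem setIntegral_Ioi_comp_add (f : ℝ → ℝ) (q : ℝ) :
    ∫ x in Ioi (0 : ℝ), f (x + q) = ∫ x in Ioi q, f x := by
  have := (measurePreserving_add_right volume q).setIntegral_preimage_emb
    (MeasurableEquiv.addRight q).measurableEmbedding f (Ioi q)
  have e : (MeasurableEquiv.addRight q) ⁻¹' Ioi q = Ioi (0 : ℝ) := by ext; simp
  rw [← this, ← e]; rfl

/-- At order 0 the kernel is 1, so `weylInt 0 w` is the tail integral of w: the primitive of -w that
vanishes after T. -/
theorem weylInt_zero_sub {T B : ℝ} {w : ℝ → ℝ} (hw : IsTame T B w) {s q : ℝ} (hs : 0 ≤ s)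
    (hq : 0 ≤ q) : weylInt 0 w s - weylInt 0 w (s + q) = ∫ x in Ioc 0 q, w (s + x) := by
  have h1 : weylInt 0 w (s + q) = ∫ x in Ioi q, w (s + x) := by
    rw [weylInt, ← setIntegral_Ioi_comp_add (fun x => w (s + x)) q]
    simp [add_assoc, add_comm q]
  have h2 : weylInt 0 w s = ∫ x in Ioc 0 q ∪ Ioi q, w (s + x) := by
    rw [Ioc_union_Ioi_eq_Ioi hq]; simp [weylInt]
  have h3 : IntegrableOn (fun x => w (s + x)) (Ioc 0 q ∪ Ioi q) := by
    rw [Ioc_union_Ioi_eq_Ioi hq]; exact hw.integrableOn hs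
  rw [h1, h2, setIntegral_union Ioc_disjoint_Ioi_same measurableSet_Ioi
    h3.left_of_union h3.right_of_union]
  ring

/-- Fubini kernel for the Marchaud derivative of a primitive. -/
theorem integrable_mul_indicator_rpow {T B : ℝ} {w : ℝ → ℝ} (hw : IsTame T B w) {s p : ℝ}
    (hs : 0 ≤ s) (hp0 : 0 < p) (hp : p < 1) :
    Integrable (fun z : ℝ × ℝ => w (s + z.1) * (Ioi z.1).indicator (fun q => q ^ (-1 - p)) z.2)
      ((volume.restrict (Ioi 0)).prod (volume.restrict (Ioi 0))) := by
  have hm : Measurable (fun z : ℝ × ℝ =>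
      w (s + z.1) * (Ioi z.1).indicator (fun q => q ^ (-1 - p)) z.2) := by
    have h1 := hw.measurable
    have : (fun z : ℝ × ℝ => (Ioi z.1).indicator (fun q => q ^ (-1 - p)) z.2) =
        {z : ℝ × ℝ | z.1 < z.2}.indicator (fun z => z.2 ^ (-1 - p)) := by
      ext z; simp [indicator]
    have h2 : Measurable (fun z : ℝ × ℝ => (Ioi z.1).indicator (fun q => q ^ (-1 - p)) z.2) := by
      rw [this]
      exact (by fun_prop : Measurable fun z : ℝ × ℝ => z.2 ^ (-1 - p)).indicator
        (measurableSet_lt measurable_fst measurable_snd)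
    exact Measurable.mul (by fun_prop) h2
  have hI : ∀ x : ℝ, 0 < x → Integrable (fun q => (Ioi x).indicator (fun q => q ^ (-1 - p)) q)
      (volume.restrict (Ioi 0)) := fun x hx =>
    ((integrable_indicator_iff measurableSet_Ioi).2
      (integrableOn_Ioi_rpow_of_lt (by linarith) hx)).integrableOn
  rw [integrable_prod_iff hm.aestronglyMeasurable]
  constructor
  · filter_upwards [ae_restrict_mem measurableSet_Ioi] with x hx
    exact (hI x hx).const_mul _
  · refine ((hw.integrableOn_mul_rpow hs hp).norm.const_mul (1 / p)).congr ?_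
    filter_upwards [ae_restrict_mem measurableSet_Ioi] with x hx
    have hx : 0 < x := hx
    simp only [norm_mul]
    rw [integral_const_mul]
    have : ∫ q in Ioi (0 : ℝ), ‖(Ioi x).indicator (fun q : ℝ => q ^ (-1 - p)) q‖ =
        ∫ q in Ioi x, q ^ (-1 - p) := by
      rw [← integral_indicator measurableSet_Ioi, ← integral_indicator measurableSet_Ioi]
      congr 1 with q
      by_cases h : x < q
      · have : 0 < q := hx.trans h
        simp [indicator, h, this, abs_of_pos (Real.rpow_pos_of_pos this _)]
      · simp [indicator, h]
    rw [this, integral_Ioi_rpow_of_lt (by linarith) hx, Real.norm_of_nonneg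
      (Real.rpow_nonneg hx.le (-p))]
    rw [show -1 - p + 1 = -p by ring]
    field_simp

/-- The Marchaud derivative of a primitive is a Riemann–Liouville integral. -/
theorem marchaudRight_weylInt_zero {T B : ℝ} {w : ℝ → ℝ} (hw : IsTame T B w) {s p : ℝ}
    (hs : 0 ≤ s) (hp0 : 0 < p) (hp : p < 1) :
    marchaudRight p (weylInt 0 w) s = 1 / p * weylInt p w s := by
  have key := integral_integral_swap
    (f := fun x q => w (s + x) * (Ioi x).indicator (fun q => q ^ (-1 - p)) q)
    (integrable_mul_indicator_rpow hw hs hp0 hp)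
  have h1 : ∫ x in Ioi (0 : ℝ), ∫ q in Ioi (0 : ℝ),
      w (s + x) * (Ioi x).indicator (fun q => q ^ (-1 - p)) q = 1 / p * weylInt p w s := by
    rw [weylInt, ← integral_const_mul]
    refine setIntegral_congr_fun measurableSet_Ioi fun x hx => ?_
    have hx : 0 < x := hx
    rw [integral_const_mul, setIntegral_indicator measurableSet_Ioi,
      inter_eq_right.2 (Ioi_subset_Ioi hx.le), integral_Ioi_rpow_of_lt (by linarith) hx,
      show -1 - p + 1 = -p by ring]
    field_simp
  rw [← h1, key, marchaudRight]
  refine setIntegral_congr_fun measurableSet_Ioi fun q hq => ?_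
  have hq : 0 < q := hq
  rw [weylInt_zero_sub hw hs hq.le, ← integral_mul_const,
    ← integral_indicator measurableSet_Ioc, ← integral_indicator measurableSet_Ioi]
  refine integral_congr_ae ?_
  -- The interval `Ioc 0 q` contains x = q while the kernel needs x < q; this one point is
  -- discarded.
  filter_upwards [compl_mem_ae_iff.2 (measure_singleton q)] with x hx
  have hx : x ≠ q := hx
  by_cases h0 : 0 < x <;> by_cases h : x < q
  · simp [indicator, h0, h, h.le]
  · have h' : ¬ x ≤ q := fun h' => h (lt_of_le_of_ne h' hx)
    simp [indicator, h0, h, h']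
  · simp [indicator, h0]
  · simp [indicator, h0]

theorem IsTame.integrable_prod {T B : ℝ} {w : ℝ → ℝ} (hw : IsTame T B w) {s p r : ℝ}
    (hs : 0 ≤ s) (hp : p < 1) (hr : r < 1) :
    Integrable (fun z : ℝ × ℝ => w (s + z.1 + z.2) * z.2 ^ (-p) * z.1 ^ (-r))
      ((volume.restrict (Ioi 0)).prod (volume.restrict (Ioi 0))) := by
  have h1 : Integrable (fun z : ℝ × ℝ => (Ioc 0 T).indicator (fun x : ℝ => x ^ (-r)) z.1 *
      (B * (Ioc 0 T).indicator (fun x : ℝ => x ^ (-p)) z.2))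
      ((volume.restrict (Ioi 0)).prod (volume.restrict (Ioi 0))) :=
    Integrable.mul_prod (integrable_indicator_Ioc_rpow_neg T hr).integrableOn
      ((integrable_indicator_Ioc_rpow_neg T hp).const_mul B).integrableOn
  refine h1.mono' (by have := hw.measurable; fun_prop) ?_
  rw [Measure.prod_restrict]
  filter_upwards [ae_restrict_mem (measurableSet_Ioi.prod measurableSet_Ioi)] with z hz
  have hz1 : 0 < z.1 := hz.1
  have hz2 : 0 < z.2 := hz.2
  rw [norm_mul, mul_comm, Real.norm_of_nonneg (Real.rpow_nonneg hz1.le (-r))]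
  by_cases h : z.1 ≤ T
  · rw [indicator_of_mem (show z.1 ∈ Ioc 0 T from ⟨hz1, h⟩)]
    exact mul_le_mul_of_nonneg_left (hw.abs_le_indicator (by linarith) hz2 _)
      (Real.rpow_nonneg hz1.le _)
  · rw [hw.eq_zero _ (by linarith)]
    simp only [zero_mul, norm_zero, mul_zero]
    exact mul_nonneg (indicator_Ioc_rpow_nonneg _ _ _)
      (mul_nonneg hw.bound_nonneg (indicator_Ioc_rpow_nonneg _ _ _))

/-- Both sides are the same double integral over the two lags, with the order of integration
exchanged. -/
theorem weylInt_comm {T B : ℝ} {w : ℝ → ℝ} (hw : IsTame T B w) {s p r : ℝ}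
    (hs : 0 ≤ s) (hp : p < 1) (hr : r < 1) :
    weylInt r (weylInt p w) s = weylInt p (weylInt r w) s := by
  have key := integral_integral_swap
    (f := fun y x => w (s + y + x) * x ^ (-p) * y ^ (-r)) (hw.integrable_prod hs hp hr)
  simp only [weylInt, ← integral_mul_const]
  rw [key]
  refine integral_congr_ae (ae_of_all _ fun x => integral_congr_ae (ae_of_all _ fun y => ?_))
  simp only
  rw [add_right_comm]; ring

/-- This is the Beta integral B(1-a, a), with Γ(1) = 1 in the denominator. The exponents add up to
-1, so scaling by z leaves no power of z. -/
theorem integral_rpow_mul_rpow_sub {a z : ℝ} (ha0 : 0 < a) (ha : a < 1) (hz : 0 < z) :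
    ∫ y in Ioo 0 z, (z - y) ^ (-(1 - a)) * y ^ (-a) = Real.Gamma a * Real.Gamma (1 - a) := by
  have h := Complex.betaIntegral_scaled ((1 - a : ℝ) : ℂ) (a : ℂ) hz
  have hb := Complex.Gamma_mul_Gamma_eq_betaIntegral (s := ((1 - a : ℝ) : ℂ)) (t := (a : ℂ))
    (by rw [Complex.ofReal_re]; linarith) (by simpa using ha0)
  have e : (((1 - a : ℝ) : ℂ) + (a : ℂ)) = 1 := by push_cast; ring
  rw [e, Complex.Gamma_one, one_mul, Complex.Gamma_ofReal, Complex.Gamma_ofReal] at hb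
  rw [e, sub_self, Complex.cpow_zero, one_mul, ← hb, intervalIntegral.integral_of_le hz.le,
    integral_Ioc_eq_integral_Ioo] at h
  have h2 : ∫ y in Ioo 0 z, (y : ℂ) ^ (((1 - a : ℝ) : ℂ) - 1) * ((z : ℂ) - y) ^ ((a : ℂ) - 1) =
      ∫ y in Ioo 0 z, (((z - y) ^ (-(1 - a)) * y ^ (-a) : ℝ) : ℂ) := by
    refine setIntegral_congr_fun measurableSet_Ioo fun y hy => ?_
    rw [Complex.ofReal_mul, Complex.ofReal_cpow hy.1.le, Complex.ofReal_cpow (by linarith [hy.2])]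
    push_cast
    rw [mul_comm]
    congr 2 <;> ring
  rw [h2, integral_complex_ofReal, ← Complex.ofReal_mul] at h
  rw [mul_comm (Real.Gamma a)]
  exact_mod_cast h

/-- Semigroup law: the convolution of the kernels x^(-(1-a)) and y^(-a) is the constant Beta value,
so the composition is that constant times a tail integral. -/
theorem weylInt_weylInt {T B : ℝ} {w : ℝ → ℝ} (hw : IsTame T B w) {s a : ℝ}
    (hs : 0 ≤ s) (ha0 : 0 < a) (ha : a < 1) :
    weylInt a (weylInt (1 - a) w) s =
      Real.Gamma a * Real.Gamma (1 - a) * weylInt 0 w s := by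
  set C := Real.Gamma a * Real.Gamma (1 - a) with hC
  have hCpos : 0 < C :=
    mul_pos (Real.Gamma_pos_of_pos ha0) (Real.Gamma_pos_of_pos (by linarith))
  let k : ℝ → ℝ → ℝ := fun z => (Ioo 0 z).indicator fun y => (z - y) ^ (-(1 - a)) * y ^ (-a)
  have hk0 : ∀ z y, 0 ≤ k z y := fun z y => indicator_nonneg (fun y (hy : y ∈ Ioo 0 z) =>
    mul_nonneg (Real.rpow_nonneg (by linarith [hy.2]) _) (Real.rpow_nonneg hy.1.le _)) y
  have hkC : ∀ z, 0 < z → ∫ y in Ioi 0, k z y = C := fun z hz => by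
    rw [setIntegral_indicator measurableSet_Ioo, inter_eq_right.2 Ioo_subset_Ioi_self]
    exact integral_rpow_mul_rpow_sub ha0 ha hz
  have hm : Measurable fun p : ℝ × ℝ => w (s + p.2) * k p.2 p.1 := by
    have h1 := hw.measurable
    have h2 : Measurable fun p : ℝ × ℝ => k p.2 p.1 := by
      have : (fun p : ℝ × ℝ => k p.2 p.1) = {p : ℝ × ℝ | 0 < p.1 ∧ p.1 < p.2}.indicator
          fun p => (p.2 - p.1) ^ (-(1 - a)) * p.1 ^ (-a) := by
        ext p; simp [k, indicator]
      rw [this]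
      exact Measurable.indicator (by fun_prop) ((measurableSet_lt measurable_const
        measurable_fst).inter (measurableSet_lt measurable_fst measurable_snd))
    exact Measurable.mul (by fun_prop) h2
  have hint : Integrable (fun p : ℝ × ℝ => w (s + p.2) * k p.2 p.1)
      ((volume.restrict (Ioi 0)).prod (volume.restrict (Ioi 0))) := by
    rw [integrable_prod_iff' hm.aestronglyMeasurable]
    constructor
    · filter_upwards [ae_restrict_mem measurableSet_Ioi] with z hz
      refine Integrable.const_mul ?_ _
      -- A non-integrable function has Bochner integral 0, whereas `hkC` gives a positive value.
      by_contra h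
      exact hCpos.ne (by rw [← hkC z hz, integral_undef h])
    · refine ((hw.integrableOn hs).norm.mul_const C).congr ?_
      filter_upwards [ae_restrict_mem measurableSet_Ioi] with z hz
      simp only [norm_mul]
      rw [integral_const_mul, ← hkC z hz]
      congr 1
      refine integral_congr_ae (ae_of_all _ fun y => ?_)
      exact (Real.norm_of_nonneg (hk0 z y)).symm
  have key := integral_integral_swap (f := fun y z => w (s + z) * k z y) hint
  have h1 : ∫ z in Ioi (0 : ℝ), ∫ y in Ioi (0 : ℝ), w (s + z) * k z y = C * weylInt 0 w s := by
    rw [weylInt, ← integral_const_mul]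
    refine setIntegral_congr_fun measurableSet_Ioi fun z hz => ?_
    rw [integral_const_mul, hkC z hz]
    simp [mul_comm]
  rw [← h1, ← key]
  rw [weylInt]
  refine setIntegral_congr_fun measurableSet_Ioi fun y hy => ?_
  have hy : 0 < y := hy
  simp only [weylInt]
  -- The substitution z = x + y makes the total lag the variable; the kernel `k z y` vanishes unless
  -- y < z.
  have h2 := setIntegral_Ioi_comp_add (fun z => w (s + z) * k z y) y
  have h3 : ∫ z in Ioi (0 : ℝ), w (s + z) * k z y = ∫ z in Ioi y, w (s + z) * k z y := by
    refine setIntegral_eq_of_subset_of_forall_sdiff_eq_zero measurableSet_Ioi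
      (Ioi_subset_Ioi hy.le) fun z hz => ?_
    have : ¬ y < z := hz.2
    simp [k, this]
  rw [h3, ← h2, ← integral_mul_const]
  refine setIntegral_congr_fun measurableSet_Ioi fun x hx => ?_
  have hx : 0 < x := hx
  simp [k, hx, hy]
  ring_nf

/-! ### Translations and forward moving averages -/

/-- Continuity of translations in `L¹(ℝ)`. -/
theorem tendsto_lintegral_enorm_translate_sub {u : ℝ → ℝ} (hu : Integrable u) :
    Tendsto (fun z => ∫⁻ s, ‖u (s - z) - u s‖ₑ) (𝓝 0) (𝓝 0) := by
  have hL := memLp_one_iff_integrable.2 hu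
  let g : C(ℝ, C(ℝ, ℝ)) :=
    (ContinuousMap.mk (fun p : ℝ × ℝ => p.2 - p.1) (by fun_prop)).curry
  have hg : ∀ z, MeasurePreserving (g z) (volume : Measure ℝ) volume := fun z =>
    measurePreserving_sub_right volume z
  have : Fact ((1 : ℝ≥0∞) ≤ 1) := ⟨le_rfl⟩
  have hc : Continuous fun z => Lp.compMeasurePreserving (g z) (hg z) (hL.toLp u) :=
    continuous_const.compMeasurePreservingLp g.continuous hg ENNReal.one_ne_top
  have h0 := hc.tendsto 0
  rw [Lp.tendsto_Lp_iff_tendsto_eLpNorm'] at h0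
  refine h0.congr fun z => ?_
  rw [eLpNorm_one_eq_lintegral_enorm]
  refine lintegral_congr_ae ?_
  have h1 : ∀ y, (Lp.compMeasurePreserving (g y) (hg y) (hL.toLp u)) =ᵐ[volume]
      fun s => u (s - y) := fun y => by
    refine (Lp.coeFn_compMeasurePreserving _ (hg y)).trans ?_
    exact (hg y).quasiMeasurePreserving.ae_eq_comp hL.coeFn_toLp
  filter_upwards [h1 z, h1 0] with s hs hs0
  rw [Pi.sub_apply, hs, hs0, sub_zero]

/-- The pairing of an integrable function with translates of a bounded one is continuous. -/
theorem IsTame.tendsto_integral_mul_translate {T A : ℝ} {F u : ℝ → ℝ} (hF : IsTame T A F)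
    (hu : IntegrableOn u (Ioc 0 T)) :
    Tendsto (fun z => ∫ s in Ioc 0 T, u s * F (s + z)) (𝓝[≥] 0)
      (𝓝 (∫ s in Ioc 0 T, u s * F s)) := by
  set v : ℝ → ℝ := (Ioc 0 T).indicator u with hv
  have hvi : Integrable v := (integrable_indicator_iff measurableSet_Ioc).2 hu
  -- F is bounded only on [0, ∞) and need not be continuous. For z ≥ 0 cutting it off at 0 changes
  -- nothing, and the translation can then be moved onto the integrable factor.
  set G : ℝ → ℝ := (Ici 0).indicator F with hG
  have hGm : Measurable G := hF.measurable.indicator measurableSet_Ici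
  have hGb : ∀ s, ‖G s‖ ≤ A := fun s => by
    by_cases h : s ∈ Ici (0 : ℝ)
    · simpa [hG, h] using hF.abs_le s h
    · simpa [hG, h] using hF.bound_nonneg
  have e1 : ∀ z, 0 ≤ z → ∫ s in Ioc 0 T, u s * F (s + z) = ∫ s, v (s - z) * G s := fun z hz => by
    rw [← integral_add_right_eq_self (fun s => v (s - z) * G s) z,
      ← integral_indicator measurableSet_Ioc]
    congr 1 with s
    by_cases h : s ∈ Ioc 0 T
    · have : 0 ≤ s + z := by linarith [h.1]
      simp [hv, hG, h, this]
    · simp [hv, h]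
  have e0 : ∫ s in Ioc 0 T, u s * F s = ∫ s, v s * G s := by
    have := e1 0 le_rfl
    simpa using this
  rw [e0]
  refine Tendsto.congr' (f₁ := fun z => ∫ s, v (s - z) * G s) ?_ ?_
  · filter_upwards [self_mem_nhdsWithin] with z hz using (e1 z hz).symm
  · refine tendsto_nhdsWithin_of_tendsto_nhds ?_
    refine tendsto_integral_of_L1 _ ?_ (Eventually.of_forall fun z => ?_) ?_
    · exact hvi.aestronglyMeasurable.mul hGm.aestronglyMeasurable
    · exact (hvi.comp_sub_right z).mul_bdd hGm.aestronglyMeasurable (ae_of_all _ hGb)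
    · have h := ENNReal.Tendsto.const_mul (a := ENNReal.ofReal A)
        (tendsto_lintegral_enorm_translate_sub hvi) (Or.inr ENNReal.ofReal_ne_top)
      rw [mul_zero] at h
      refine tendsto_of_tendsto_of_tendsto_of_le_of_le tendsto_const_nhds h
        (fun _ => zero_le) fun z => ?_
      simp only
      rw [← lintegral_const_mul' _ _ ENNReal.ofReal_ne_top]
      refine lintegral_mono fun s => ?_
      rw [← sub_mul, enorm_mul, mul_comm]
      gcongr
      rw [← ofReal_norm]
      exact ENNReal.ofReal_le_ofReal (hGb s)

/-- The (unnormalised) forward moving average. -/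
noncomputable def movingInt (ε : ℝ) (h : ℝ → ℝ) (s : ℝ) : ℝ := ∫ x in Ioc 0 ε, h (s + x)

theorem measurable_movingInt {h : ℝ → ℝ} (hh : Measurable h) (ε : ℝ) :
    Measurable (movingInt ε h) := by
  have : Measurable (fun z : ℝ × ℝ => h (z.1 + z.2)) := by fun_prop
  exact (this.stronglyMeasurable.integral_prod_right (ν := volume.restrict (Ioc 0 ε))).measurable

/-- Double forward averages of a function converge to its right limit. -/
theorem tendsto_double_average {c : ℝ → ℝ} {L M : ℝ} (hcm : Measurable c)
    (hcb : ∀ z, 0 ≤ z → |c z| ≤ M) (hcL : Tendsto c (𝓝[≥] 0) (𝓝 L)) :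
    Tendsto (fun ε => ε⁻¹ ^ 2 * ∫ x in Ioc 0 ε, ∫ y in Ioc 0 ε, c (x + y)) (𝓝[>] 0) (𝓝 L) := by
  rw [Metric.tendsto_nhds]
  intro η hη
  have h1 : ∀ᶠ z in 𝓝[≥] (0 : ℝ), dist (c z) L < η / 2 :=
    (Metric.tendsto_nhds.1 hcL) _ (half_pos hη)
  rw [eventually_nhdsWithin_iff, Metric.eventually_nhds_iff] at h1
  obtain ⟨δ, hδ, h1⟩ := h1
  -- Half of δ, because the total lag x + y reaches 2ε.
  have h2 : Ioo (0 : ℝ) (δ / 2) ∈ 𝓝[>] (0 : ℝ) := Ioo_mem_nhdsGT (half_pos hδ)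
  filter_upwards [h2] with ε hε
  have hε0 := hε.1
  have hclose : ∀ x ∈ Ioc 0 ε, ∀ y ∈ Ioc 0 ε, |c (x + y) - L| ≤ η / 2 := fun x hx y hy => by
    have := h1 (y := x + y) (by
      rw [Real.dist_eq, sub_zero, abs_of_pos (by linarith [hx.1, hy.1])]
      linarith [hx.2, hy.2, hε.2]) (by simp only [mem_Ici]; linarith [hx.1, hy.1])
    exact this.le
  have hint : ∀ x ∈ Ioc 0 ε, IntegrableOn (fun y => c (x + y)) (Ioc 0 ε) := fun x hx => by
    refine IntegrableOn.of_bound (by simp) ?_ M ?_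
    · exact (hcm.comp (measurable_const_add x)).aestronglyMeasurable
    · filter_upwards [ae_restrict_mem measurableSet_Ioc] with y hy
      exact hcb _ (by linarith [hx.1, hy.1])
  have hin : ∀ x ∈ Ioc 0 ε, |(∫ y in Ioc 0 ε, c (x + y)) - ε * L| ≤ η / 2 * ε := fun x hx => by
    have h3 : (∫ y in Ioc 0 ε, c (x + y)) - ε * L = ∫ y in Ioc 0 ε, (c (x + y) - L) := by
      rw [integral_sub (hint x hx) (by simp)]
      simp [hε0.le]
    rw [h3]
    have := norm_setIntegral_le_of_norm_le_const (μ := volume) (s := Ioc 0 ε)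
      (f := fun y => c (x + y) - L) (C := η / 2) (by simp) (fun y hy => hclose x hx y hy)
    simpa [hε0.le] using this
  have hmm : Measurable (fun x => ∫ y in Ioc 0 ε, c (x + y)) := by
    have h1 : Measurable (fun z : ℝ × ℝ => c (z.1 + z.2)) := by fun_prop
    exact (h1.stronglyMeasurable.integral_prod_right (ν := volume.restrict (Ioc 0 ε))).measurable
  have hci : IntegrableOn (fun x => ∫ y in Ioc 0 ε, c (x + y)) (Ioc 0 ε) := by
    refine IntegrableOn.of_bound (by simp) hmm.aestronglyMeasurable (η / 2 * ε + |ε * L|) ?_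
    filter_upwards [ae_restrict_mem measurableSet_Ioc] with x hx
    have h5 := hin x hx
    have h6 := abs_add_le ((∫ y in Ioc 0 ε, c (x + y)) - ε * L) (ε * L)
    rw [sub_add_cancel] at h6
    rw [Real.norm_eq_abs]; linarith
  have hout : |(∫ x in Ioc 0 ε, ∫ y in Ioc 0 ε, c (x + y)) - ε * (ε * L)| ≤ η / 2 * ε * ε := by
    have h3 : (∫ x in Ioc 0 ε, ∫ y in Ioc 0 ε, c (x + y)) - ε * (ε * L) =
        ∫ x in Ioc 0 ε, ((∫ y in Ioc 0 ε, c (x + y)) - ε * L) := by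
      rw [integral_sub hci (integrable_const _)]
      simp [hε0.le]
    rw [h3]
    have := norm_setIntegral_le_of_norm_le_const (μ := volume) (s := Ioc 0 ε)
      (f := fun x => (∫ y in Ioc 0 ε, c (x + y)) - ε * L) (C := η / 2 * ε) (by simp) hin
    simpa [hε0.le] using this
  rw [Real.dist_eq]
  have h4 : ε⁻¹ ^ 2 * (∫ x in Ioc 0 ε, ∫ y in Ioc 0 ε, c (x + y)) - L =
      ε⁻¹ ^ 2 * ((∫ x in Ioc 0 ε, ∫ y in Ioc 0 ε, c (x + y)) - ε * (ε * L)) := by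
    field_simp
  rw [h4, abs_mul, abs_of_pos (by positivity)]
  calc ε⁻¹ ^ 2 * |(∫ x in Ioc 0 ε, ∫ y in Ioc 0 ε, c (x + y)) - ε * (ε * L)|
      ≤ ε⁻¹ ^ 2 * (η / 2 * ε * ε) := by gcongr
    _ = η / 2 := by field_simp
    _ < η := half_lt_self hη

namespace IsTame

variable {T B A : ℝ} {h F u : ℝ → ℝ}

theorem movingInt (hh : IsTame T B h) {ε : ℝ} (hε : 0 ≤ ε) :
    IsTame T (B * ε) (movingInt ε h) where
  measurable := measurable_movingInt hh.measurable ε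
  abs_le s hs := by
    have := norm_setIntegral_le_of_norm_le_const (μ := volume) (s := Ioc 0 ε)
      (f := fun x => h (s + x)) (C := B) (by simp)
      (fun x hx => hh.abs_le _ (by linarith [hx.1]))
    simpa [_root_.movingInt, hε] using this
  eq_zero s hs := by
    rw [_root_.movingInt]
    refine (setIntegral_congr_fun measurableSet_Ioc fun x hx => ?_).trans (integral_zero _ _)
    exact hh.eq_zero _ (by linarith [hx.1])

theorem comp_add_right (hh : IsTame T B h) {z : ℝ} (hz : 0 ≤ z) :
    IsTame T B (fun s => h (s + z)) where
  measurable := by have := hh.measurable; fun_prop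
  abs_le s hs := hh.abs_le _ (by linarith)
  eq_zero s hs := hh.eq_zero _ (by linarith)

/-- The tail integrals from s and from s + ε cancel except on a window of length ε. -/
theorem weylInt_zero_sub_comp_add (hh : IsTame T B h) {ε s : ℝ} (hε : 0 ≤ ε) (hs : 0 ≤ s) :
    _root_.weylInt 0 (fun s => h s - h (s + ε)) s = _root_.movingInt ε h s := by
  have h1 := weylInt_zero_sub hh hs hε
  rw [_root_.movingInt, ← h1]
  simp only [_root_.weylInt, neg_zero, Real.rpow_zero, mul_one]
  rw [← integral_sub (hh.integrableOn hs) (hh.integrableOn (by linarith))]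
  simp only [add_right_comm s _ ε]

theorem movingInt_sub_comp_add (hh : IsTame T B h) {ε δ s : ℝ} (hε : 0 ≤ ε) (hs : 0 ≤ s) :
    _root_.movingInt δ (fun s => h s - h (s + ε)) s =
      _root_.movingInt δ h s - _root_.movingInt δ h (s + ε) := by
  simp only [_root_.movingInt]
  rw [← integral_sub ((hh.integrableOn hs).mono_set Ioc_subset_Ioi_self)
    ((hh.integrableOn (by linarith)).mono_set Ioc_subset_Ioi_self)]
  simp only [add_right_comm s _ ε]

/-- The double moving average is a second primitive of a double difference. -/
theorem weylInt_zero_weylInt_zero (hh : IsTame T B h) {ε s : ℝ} (hε : 0 ≤ ε) (hs : 0 ≤ s) :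
    _root_.weylInt 0 (_root_.weylInt 0
      (fun s => (h s - h (s + ε)) - (h (s + ε) - h (s + ε + ε)))) s =
      _root_.movingInt ε (_root_.movingInt ε h) s := by
  rw [← (hh.movingInt hε).weylInt_zero_sub_comp_add hε hs]
  simp only [_root_.weylInt]
  refine setIntegral_congr_fun measurableSet_Ioi fun x hx => ?_
  have hx : 0 ≤ s + x := by linarith [mem_Ioi.1 hx]
  have := (hh.sub_comp_add hε).weylInt_zero_sub_comp_add hε hx
  rw [_root_.weylInt] at this
  rw [this, hh.movingInt_sub_comp_add hε hx]

theorem integral_mul_movingInt (hF : IsTame T A F) (hu : IntegrableOn u (Ioc 0 T)) (ε : ℝ) :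
    ∫ s in Ioc 0 T, u s * _root_.movingInt ε F s =
      ∫ x in Ioc 0 ε, ∫ s in Ioc 0 T, u s * F (s + x) := by
  have hint : Integrable (fun z : ℝ × ℝ => u z.1 * F (z.1 + z.2))
      ((volume.restrict (Ioc 0 T)).prod (volume.restrict (Ioc 0 ε))) := by
    have h1 : Integrable (fun z : ℝ × ℝ => u z.1)
        ((volume.restrict (Ioc 0 T)).prod (volume.restrict (Ioc 0 ε))) :=
      Integrable.comp_fst hu _
    refine h1.mul_bdd (c := A) (hF.measurable.comp
      (measurable_fst.add measurable_snd)).aestronglyMeasurable ?_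
    rw [Measure.prod_restrict]
    filter_upwards [ae_restrict_mem (measurableSet_Ioc.prod measurableSet_Ioc)] with z hz
    exact hF.abs_le _ (by linarith [hz.1.1, hz.2.1])
  rw [← integral_integral_swap (f := fun s x => u s * F (s + x)) hint]
  simp only [_root_.movingInt, integral_const_mul]

/-- By Fubini the double average can be taken outside the pairing. It then acts on the function z ↦
∫ u F(· + z), which is right continuous at 0 although F is only bounded and measurable. -/
theorem tendsto_integral_mul_movingInt (hF : IsTame T A F) (hum : Measurable u)
    (hu : IntegrableOn u (Ioc 0 T)) :
    Tendsto (fun ε => ε⁻¹ ^ 2 * ∫ s in Ioc 0 T, u s * _root_.movingInt ε (_root_.movingInt ε F) s)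
      (𝓝[>] 0) (𝓝 (∫ s in Ioc 0 T, u s * F s)) := by
  set c : ℝ → ℝ := fun z => ∫ s in Ioc 0 T, u s * F (s + z) with hc
  set L := ∫ s in Ioc 0 T, u s * F s with hL
  have hcL : Tendsto c (𝓝[≥] 0) (𝓝 L) := hF.tendsto_integral_mul_translate hu
  have hcb : ∀ z, 0 ≤ z → |c z| ≤ A * ∫ s in Ioc 0 T, |u s| := fun z hz => by
    rw [hc, ← integral_const_mul, ← Real.norm_eq_abs]
    refine norm_integral_le_of_norm_le (hu.norm.const_mul A) ?_
    filter_upwards [ae_restrict_mem measurableSet_Ioc] with s hs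
    rw [norm_mul, mul_comm]
    exact mul_le_mul_of_nonneg_right (hF.abs_le _ (by linarith [hs.1])) (norm_nonneg _)
  have hcm : Measurable c := by
    have h1 : Measurable (fun z : ℝ × ℝ => u z.2 * F (z.2 + z.1)) := by
      have := hF.measurable
      fun_prop
    exact (h1.stronglyMeasurable.integral_prod_right (ν := volume.restrict (Ioc 0 T))).measurable
  have e : ∀ ε, 0 < ε → ∫ s in Ioc 0 T, u s * _root_.movingInt ε (_root_.movingInt ε F) s =
      ∫ x in Ioc 0 ε, ∫ y in Ioc 0 ε, c (x + y) := fun ε hε => by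
    rw [(hF.movingInt hε.le).integral_mul_movingInt hu]
    refine setIntegral_congr_fun measurableSet_Ioc fun x hx => ?_
    have h1 := (hF.comp_add_right hx.1.le).integral_mul_movingInt hu ε
    simp only [hc]
    simp only [_root_.movingInt] at h1 ⊢
    rw [show (∫ s in Ioc 0 T, u s * ∫ y in Ioc 0 ε, F (s + x + y)) =
      ∫ s in Ioc 0 T, u s * ∫ y in Ioc 0 ε, F (s + y + x) by
        simp only [add_right_comm _ x], h1]
    refine integral_congr_ae (ae_of_all _ fun y => integral_congr_ae (ae_of_all _ fun s => ?_))
    simp only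
    congr 2; ring
  refine (tendsto_double_average hcm hcb hcL).congr' ?_
  filter_upwards [self_mem_nhdsWithin] with ε hε
  rw [e ε hε]

end IsTame

/-! ### Marchaud derivatives, integration by parts and independence of the order -/

theorem weylInt_const_mul (p c : ℝ) (w : ℝ → ℝ) (s : ℝ) :
    weylInt p (fun s => c * w s) s = c * weylInt p w s := by
  rw [weylInt, weylInt, ← integral_const_mul]
  simp only [mul_assoc]

/-- Tame functions whose Marchaud derivative of order `p` converges absolutely and uniformly. -/
structure IsTameMarchaud (T B p A : ℝ) (h : ℝ → ℝ) : Prop where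
  tame : IsTame T B h
  nonneg : 0 ≤ A
  lintegral_le : ∀ s, 0 ≤ s →
    ∫⁻ q in Ioi (0 : ℝ), ‖(h s - h (s + q)) * q ^ (-1 - p)‖ₑ ≤ ENNReal.ofReal A

theorem measurable_marchaudRight {h : ℝ → ℝ} (hh : Measurable h) (p : ℝ) :
    Measurable (marchaudRight p h) := by
  have : Measurable (fun z : ℝ × ℝ => (h z.1 - h (z.1 + z.2)) * z.2 ^ (-1 - p)) := by fun_prop
  exact (this.stronglyMeasurable.integral_prod_right (ν := volume.restrict (Ioi 0))).measurable

theorem measurable_marchaudLeft {h : ℝ → ℝ} (hh : Measurable h) (p : ℝ) :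
    Measurable (marchaudLeft p h) := by
  have : Measurable (fun z : ℝ × ℝ => (h z.1 - h (z.1 - z.2)) * z.2 ^ (-1 - p)) := by fun_prop
  exact (this.stronglyMeasurable.integral_prod_right (ν := volume.restrict (Ioi 0))).measurable

namespace IsTameMarchaud

variable {T B p A : ℝ} {h : ℝ → ℝ}

theorem integrableOn (hh : IsTameMarchaud T B p A h) {s : ℝ} (hs : 0 ≤ s) :
    IntegrableOn (fun q => (h s - h (s + q)) * q ^ (-1 - p)) (Ioi 0) :=
  ⟨by have := hh.tame.measurable; fun_prop,
    (hh.lintegral_le s hs).trans_lt ENNReal.ofReal_lt_top⟩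

theorem marchaudRight (hh : IsTameMarchaud T B p A h) : IsTame T A (marchaudRight p h) where
  measurable := measurable_marchaudRight hh.tame.measurable p
  abs_le s hs := by
    have h1 := (enorm_integral_le_lintegral_enorm _).trans (hh.lintegral_le s hs)
    rw [← Real.norm_eq_abs, ← ENNReal.ofReal_le_ofReal_iff hh.nonneg, ofReal_norm]
    exact h1
  eq_zero s hs := by
    rw [_root_.marchaudRight]
    refine (setIntegral_congr_fun measurableSet_Ioi fun q hq => ?_).trans (integral_zero _ _)
    rw [hh.tame.eq_zero _ hs, hh.tame.eq_zero _ (by linarith [mem_Ioi.1 hq]), sub_zero, zero_mul]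

theorem lintegral_prod_le (hh : IsTameMarchaud T B p A h) {s ε : ℝ} (hs : 0 ≤ s) :
    ∫⁻ x in Ioc 0 ε, ∫⁻ q in Ioi (0 : ℝ), ‖(h (s + x) - h (s + x + q)) * q ^ (-1 - p)‖ₑ ≤
      ENNReal.ofReal (A * ε) := by
  refine (setLIntegral_mono' (g := fun _ => ENNReal.ofReal A) measurableSet_Ioc
    fun x hx => hh.lintegral_le _ (by linarith [hx.1])).trans ?_
  simp [ENNReal.ofReal_mul hh.nonneg]

theorem measurable_kernel (hh : IsTameMarchaud T B p A h) (s : ℝ) :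
    Measurable fun z : ℝ × ℝ => (h (s + z.1) - h (s + z.1 + z.2)) * z.2 ^ (-1 - p) := by
  have := hh.tame.measurable
  fun_prop

theorem integrable_kernel (hh : IsTameMarchaud T B p A h) {s ε : ℝ} (hs : 0 ≤ s) :
    Integrable (fun z : ℝ × ℝ => (h (s + z.1) - h (s + z.1 + z.2)) * z.2 ^ (-1 - p))
      ((volume.restrict (Ioc 0 ε)).prod (volume.restrict (Ioi 0))) := by
  refine ⟨(hh.measurable_kernel s).aestronglyMeasurable, ?_⟩
  rw [HasFiniteIntegral, lintegral_prod _ (hh.measurable_kernel s).enorm.aemeasurable]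
  exact (hh.lintegral_prod_le hs).trans_lt ENNReal.ofReal_lt_top

theorem movingInt_sub (hh : IsTameMarchaud T B p A h) {s ε q : ℝ} (hs : 0 ≤ s)
    (hq : 0 ≤ q) : movingInt ε h s - movingInt ε h (s + q) =
      ∫ x in Ioc 0 ε, (h (s + x) - h (s + x + q)) := by
  rw [← hh.tame.movingInt_sub_comp_add hq hs, _root_.movingInt]

theorem movingInt (hh : IsTameMarchaud T B p A h) {ε : ℝ} (hε : 0 ≤ ε) :
    IsTameMarchaud T (B * ε) p (A * ε) (movingInt ε h) where
  tame := hh.tame.movingInt hε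
  nonneg := mul_nonneg hh.nonneg hε
  lintegral_le s hs := by
    refine le_trans ?_ (hh.lintegral_prod_le hs)
    rw [lintegral_lintegral_swap (hh.measurable_kernel s).enorm.aemeasurable]
    refine setLIntegral_mono' measurableSet_Ioi fun q hq => ?_
    rw [hh.movingInt_sub hs (le_of_lt hq), ← integral_mul_const]
    exact enorm_integral_le_lintegral_enorm _

/-- The Marchaud derivative is translation invariant, so it commutes with averaging over translates;
the uniform bound on the kernel justifies Fubini. -/
theorem marchaudRight_movingInt (hh : IsTameMarchaud T B p A h) {s ε : ℝ} (hs : 0 ≤ s) :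
    _root_.marchaudRight p (_root_.movingInt ε h) s =
      _root_.movingInt ε (_root_.marchaudRight p h) s := by
  have e : _root_.movingInt ε (_root_.marchaudRight p h) s = ∫ x in Ioc 0 ε,
      ∫ q in Ioi (0 : ℝ), (h (s + x) - h (s + x + q)) * q ^ (-1 - p) := rfl
  rw [e, _root_.marchaudRight, integral_integral_swap
    (f := fun x q => (h (s + x) - h (s + x + q)) * q ^ (-1 - p)) (hh.integrable_kernel hs)]
  refine setIntegral_congr_fun measurableSet_Ioi fun q hq => ?_
  rw [hh.movingInt_sub hs (le_of_lt hq), ← integral_mul_const]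

end IsTameMarchaud

/-- Functions supported in `(0, T]`, integrable, whose left Marchaud derivative of order `p`
converges absolutely in `L¹`. -/
structure IsMarchaudLeft (T p : ℝ) (f : ℝ → ℝ) : Prop where
  measurable : Measurable f
  integrable : Integrable f
  eq_zero : ∀ s, s ∉ Ioc 0 T → f s = 0
  integrable_kernel : Integrable (fun z : ℝ × ℝ => (f z.1 - f (z.1 - z.2)) * z.2 ^ (-1 - p))
    ((volume.restrict (Ioc 0 T)).prod (volume.restrict (Ioi 0)))

/-- The kernel of the Marchaud derivative of a primitive. -/
theorem IsTame.abs_weylInt_zero_sub_le {T B : ℝ} {w : ℝ → ℝ} (hT : 0 ≤ T) (hw : IsTame T B w)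
    {s r : ℝ} (hs : 0 ≤ s) (hr : 0 ≤ r) :
    |_root_.weylInt 0 w s - _root_.weylInt 0 w (s + r)| ≤ B * min r T := by
  have key : ∀ t, 0 ≤ t → |∫ x in Ioc 0 t, w (s + x)| ≤ B * t := fun t ht => by
    have := norm_setIntegral_le_of_norm_le_const (μ := volume) (s := Ioc 0 t)
      (f := fun x => w (s + x)) (C := B) (by simp)
      (fun x hx => hw.abs_le _ (by linarith [hx.1]))
    simpa [ht] using this
  rw [weylInt_zero_sub hw hs hr]
  rcases le_total r T with h | h
  · rw [min_eq_left h]; exact key r hr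
  · rw [min_eq_right h]
    rw [setIntegral_eq_of_subset_of_forall_sdiff_eq_zero measurableSet_Ioc
      (Ioc_subset_Ioc_right h) (fun x hx => hw.eq_zero _ ?_)]
    · exact key T hT
    · have : T < x := by
        by_contra h'
        exact hx.2 ⟨hx.1.1, not_lt.1 h'⟩
      linarith

/-- The factor r tames the singularity at 0 because p < 1, and the tail converges because p > 0.
This kernel dominates the Marchaud kernel of a Lipschitz function supported up to T. -/
theorem integrableOn_min_mul_rpow {T p : ℝ} (hT : 0 < T) (hp0 : 0 < p) (hp : p < 1) :
    IntegrableOn (fun r : ℝ => min r T * r ^ (-1 - p)) (Ioi 0) := by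
  rw [← Ioc_union_Ioi_eq_Ioi hT.le]
  refine IntegrableOn.union ?_ ?_
  · have h1 : IntegrableOn (fun r : ℝ => r ^ (-p)) (Ioc 0 T) :=
      (integrable_indicator_iff measurableSet_Ioc).1 (integrable_indicator_Ioc_rpow_neg T hp)
    refine h1.congr_fun (fun r hr => ?_) measurableSet_Ioc
    simp only
    rw [min_eq_left hr.2, show -p = 1 + (-1 - p) by ring, Real.rpow_add hr.1, Real.rpow_one]
  · have h1 : IntegrableOn (fun r : ℝ => T * r ^ (-1 - p)) (Ioi T) :=
      (integrableOn_Ioi_rpow_of_lt (by linarith) hT).const_mul T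
    refine h1.congr_fun
      (fun r hr => ?_) measurableSet_Ioi
    simp only
    rw [min_eq_right (le_of_lt hr)]

namespace IsMarchaudLeft

variable {T p : ℝ} {f : ℝ → ℝ}

/-- The substitution leaves no boundary terms, since f vanishes outside (0, T] and ψ after T. -/
theorem setIntegral_comp_sub_mul {ψ : ℝ → ℝ} (hf : IsMarchaudLeft T p f) (hψ : ∀ s, T < s → ψ s = 0) {r : ℝ} (hr : 0 ≤ r) :
    ∫ s in Ioc 0 T, f (s - r) * ψ s = ∫ s in Ioc 0 T, f s * ψ (s + r) := by
  rw [← integral_indicator measurableSet_Ioc, ← integral_indicator measurableSet_Ioc,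
    ← integral_add_right_eq_self _ r]
  congr 1 with s
  by_cases h : s ∈ Ioc 0 T
  · rw [indicator_of_mem h]
    by_cases h' : s + r ≤ T
    · rw [indicator_of_mem (show s + r ∈ Ioc 0 T from ⟨by linarith [h.1], h'⟩), add_sub_cancel_right]
    · rw [indicator_of_notMem (fun h2 => h' h2.2), hψ _ (not_le.1 h'), mul_zero]
  · rw [indicator_of_notMem h]
    simp [indicator, hf.eq_zero s h]

/-- Fractional integration by parts against a primitive. -/
theorem integral_marchaudLeft_mul (hf : IsMarchaudLeft T p f) (hT : 0 < T) (hp0 : 0 < p)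
    (hp : p < 1) {B : ℝ} {w : ℝ → ℝ} (hw : IsTame T B w) :
    ∫ s in Ioc 0 T, marchaudLeft p f s * weylInt 0 w s =
      ∫ s in Ioc 0 T, f s * marchaudRight p (weylInt 0 w) s := by
  set ψ := weylInt 0 w with hψ
  have hψt := hw.weylInt (p := 0) one_pos
  rw [← hψ] at hψt
  set B' := B * ∫ x, (Ioc 0 T).indicator (fun x : ℝ => x ^ (-0 : ℝ)) x
  -- Each double integral must converge absolutely by itself: here through the fractional regularity
  -- of f against a bounded ψ, and in `i2` through the Lipschitz bound on ψ with f merely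
  -- integrable.
  have i1 : Integrable (fun z : ℝ × ℝ => (f z.1 - f (z.1 - z.2)) * z.2 ^ (-1 - p) * ψ z.1)
      ((volume.restrict (Ioc 0 T)).prod (volume.restrict (Ioi 0))) := by
    refine hf.integrable_kernel.mul_bdd (c := B')
      (hψt.measurable.comp measurable_fst).aestronglyMeasurable ?_
    rw [Measure.prod_restrict]
    filter_upwards [ae_restrict_mem (measurableSet_Ioc.prod measurableSet_Ioi)] with z hz
    exact hψt.abs_le _ hz.1.1.le
  have i2 : Integrable (fun z : ℝ × ℝ => f z.1 * ((ψ z.1 - ψ (z.1 + z.2)) * z.2 ^ (-1 - p)))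
      ((volume.restrict (Ioc 0 T)).prod (volume.restrict (Ioi 0))) := by
    have h1 : Integrable (fun z : ℝ × ℝ => f z.1 * (B * (min z.2 T * z.2 ^ (-1 - p))))
        ((volume.restrict (Ioc 0 T)).prod (volume.restrict (Ioi 0))) :=
      Integrable.mul_prod hf.integrable.integrableOn
        ((integrableOn_min_mul_rpow hT hp0 hp).const_mul B)
    refine h1.norm.mono' ?_ ?_
    · have := hψt.measurable
      have := hf.measurable
      exact Measurable.aestronglyMeasurable (by fun_prop)
    · rw [Measure.prod_restrict]
      filter_upwards [ae_restrict_mem (measurableSet_Ioc.prod measurableSet_Ioi)] with z hz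
      have h2 : 0 < z.2 := hz.2
      simp only [norm_mul]
      refine mul_le_mul_of_nonneg_left ?_ (norm_nonneg (f z.1))
      rw [← mul_assoc ‖B‖, ← norm_mul B]
      refine mul_le_mul_of_nonneg_right ?_ (norm_nonneg (z.2 ^ (-1 - p)))
      exact (hw.abs_weylInt_zero_sub_le hT.le hz.1.1.le h2.le).trans (le_abs_self _)
  have k1 := integral_integral_swap
    (f := fun s r => (f s - f (s - r)) * r ^ (-1 - p) * ψ s) i1
  have k2 := integral_integral_swap
    (f := fun s r => f s * ((ψ s - ψ (s + r)) * r ^ (-1 - p))) i2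
  simp only [integral_mul_const] at k1
  simp only [integral_const_mul] at k2
  simp only [marchaudLeft, marchaudRight]
  rw [k1, k2]
  -- After Fubini the identity holds for every fixed lag r: translating f backwards equals
  -- translating ψ forwards.
  refine setIntegral_congr_fun measurableSet_Ioi fun r hr => ?_
  have hr : 0 < r := hr
  have e1 : ∀ s, (f s - f (s - r)) * r ^ (-1 - p) * ψ s =
      (f s * ψ s - f (s - r) * ψ s) * r ^ (-1 - p) := fun s => by ring
  have e2 : ∀ s, f s * ((ψ s - ψ (s + r)) * r ^ (-1 - p)) =
      (f s * ψ s - f s * ψ (s + r)) * r ^ (-1 - p) := fun s => by ring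
  have j : ∀ (g : ℝ → ℝ) (t : ℝ), Integrable g → 0 ≤ t →
      IntegrableOn (fun s => g s * ψ (s + t)) (Ioc 0 T) := fun g t hg ht => by
    refine hg.integrableOn.mul_bdd (c := B')
      (hψt.measurable.comp (measurable_add_const t)).aestronglyMeasurable ?_
    filter_upwards [ae_restrict_mem measurableSet_Ioc] with s hs
    exact hψt.abs_le _ (by linarith [hs.1])
  have j0 := j f 0 hf.integrable le_rfl
  have j1 := j f r hf.integrable hr.le
  have j2 := j (fun s => f (s - r)) 0 (hf.integrable.comp_sub_right r) le_rfl
  simp only [add_zero] at j0 j2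
  simp only [e1, e2, integral_mul_const]
  rw [integral_sub j0 j2, integral_sub j0 j1, hf.setIntegral_comp_sub_mul hψt.eq_zero hr.le]

theorem integrableOn_marchaudLeft (hf : IsMarchaudLeft T p f) :
    IntegrableOn (marchaudLeft p f) (Ioc 0 T) := hf.integrable_kernel.integral_prod_left

/-- The pairing of Marchaud derivatives of complementary orders does not depend on the order: it
is a limit of integrals against difference quotients. -/
theorem tendsto_integral_mul_weylInt (hf : IsMarchaudLeft T p f) (hT : 0 < T) (hp0 : 0 < p)
    (hp : p < 1) {B A : ℝ} {h : ℝ → ℝ} (hh : IsTameMarchaud T B (1 - p) A h) :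
    Tendsto (fun ε => ε⁻¹ ^ 2 * ∫ s in Ioc 0 T, f s *
        weylInt 0 (fun s => (h s - h (s + ε)) - (h (s + ε) - h (s + ε + ε))) s) (𝓝[>] 0)
      (𝓝 (p * (1 - p) / (Real.Gamma p * Real.Gamma (1 - p)) *
        ∫ s in Ioc 0 T, marchaudLeft p f s * marchaudRight (1 - p) h s)) := by
  set C := Real.Gamma p * Real.Gamma (1 - p) with hC
  have hCpos : 0 < C :=
    mul_pos (Real.Gamma_pos_of_pos hp0) (Real.Gamma_pos_of_pos (by linarith))
  have hp1 : 0 < 1 - p := by linarith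
  have h1 := (hh.marchaudRight.tendsto_integral_mul_movingInt
    (measurable_marchaudLeft hf.measurable p) hf.integrableOn_marchaudLeft).const_mul
      (p * (1 - p) / C)
  refine h1.congr' ?_
  filter_upwards [self_mem_nhdsWithin] with ε hε
  have hε : 0 < ε := hε
  set w : ℝ → ℝ := fun s => (h s - h (s + ε)) - (h (s + ε) - h (s + ε + ε)) with hw
  have hwt : IsTame T (B + B + (B + B)) w :=
    (hh.tame.sub_comp_add hε.le).sub_comp_add hε.le
  -- The double average of h is a second primitive of w. The derivative of order 1 - p consumes one
  -- primitive and leaves a fractional integral of that order; commuting it inwards keeps the other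
  -- primitive outermost, ready for the integration by parts.
  have e : ∀ s ∈ Ioc 0 T, movingInt ε (movingInt ε (marchaudRight (1 - p) h)) s =
      weylInt 0 (fun s => 1 / (1 - p) * weylInt (1 - p) w s) s := fun s hs => by
    have a1 : movingInt ε (movingInt ε (marchaudRight (1 - p) h)) s =
        marchaudRight (1 - p) (movingInt ε (movingInt ε h)) s := by
      rw [(hh.movingInt hε.le).marchaudRight_movingInt hs.1.le]
      refine setIntegral_congr_fun measurableSet_Ioc fun x hx => ?_
      exact (hh.marchaudRight_movingInt (by linarith [hs.1, hx.1])).symm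
    have a2 : marchaudRight (1 - p) (movingInt ε (movingInt ε h)) s =
        marchaudRight (1 - p) (weylInt 0 (weylInt 0 w)) s := by
      refine setIntegral_congr_fun measurableSet_Ioi fun q hq => ?_
      rw [hh.tame.weylInt_zero_weylInt_zero hε.le hs.1.le,
        hh.tame.weylInt_zero_weylInt_zero hε.le (by linarith [hs.1, mem_Ioi.1 hq])]
    rw [a1, a2, marchaudRight_weylInt_zero (hwt.weylInt one_pos) hs.1.le hp1 (by linarith),
      weylInt_comm hwt hs.1.le one_pos (by linarith), ← weylInt_const_mul]
  have hvt := (hwt.weylInt (p := 1 - p) (by linarith)).const_mul (1 / (1 - p))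
  -- Integration by parts moves the derivative of order p onto the remaining primitive. The orders p
  -- and 1 - p now compose, and p survives only in the constant.
  have e2 : ∫ s in Ioc 0 T, marchaudLeft p f s *
      movingInt ε (movingInt ε (marchaudRight (1 - p) h)) s =
      ∫ s in Ioc 0 T, f s * (C / (p * (1 - p)) * weylInt 0 w s) := by
    rw [setIntegral_congr_fun measurableSet_Ioc
      (fun s hs => congrArg (marchaudLeft p f s * ·) (e s hs)),
      hf.integral_marchaudLeft_mul hT hp0 hp hvt]
    refine setIntegral_congr_fun measurableSet_Ioc fun s hs => ?_
    rw [marchaudRight_weylInt_zero hvt hs.1.le hp0 hp]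
    have : weylInt p (fun s => 1 / (1 - p) * weylInt (1 - p) w s) s =
        1 / (1 - p) * weylInt p (weylInt (1 - p) w) s := weylInt_const_mul _ _ _ _
    rw [this, weylInt_weylInt hwt hs.1.le hp0 hp, ← hC]
    field_simp
  rw [e2]
  have e3 : ∀ s, f s * (C / (p * (1 - p)) * weylInt 0 w s) =
      C / (p * (1 - p)) * (f s * weylInt 0 w s) := fun s => by ring
  simp only [e3, integral_const_mul]
  field_simp

end IsMarchaudLeft

/-! ### Besov regularity and fractional derivatives in Marchaud form -/

theorem measurable_indicator_of_domRestrict {f : ℝ → ℝ} {s t : Set ℝ} (hs : MeasurableSet s)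
    (ht : MeasurableSet t) (hts : t ⊆ s) (hf : Measurable (s.domRestrict f)) :
    Measurable (t.indicator f) := by
  have h1 : Measurable (s.indicator f) := by
    refine measurable_of_restrict_of_restrict_compl hs ?_ ?_
    · convert hf using 1
      ext x; simp
    · convert (measurable_const (a := (0 : ℝ))) using 1
      ext x; simp [indicator_of_notMem (show (x : ℝ) ∉ s from x.2)]
  have h2 : t.indicator f = t.indicator (s.indicator f) := by
    rw [indicator_indicator, inter_eq_left.2 hts]
  rw [h2]
  exact h1.indicator ht

theorem lintegral_Ioi_rpow {p c : ℝ} (hp : 0 < p) (hc : 0 < c) :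
    ∫⁻ r in Ioi c, ENNReal.ofReal (r ^ (-1 - p)) = ENNReal.ofReal (c ^ (-p) / p) := by
  rw [← ofReal_integral_eq_lintegral_ofReal (integrableOn_Ioi_rpow_of_lt (by linarith) hc),
    integral_Ioi_rpow_of_lt (by linarith) hc]
  · rw [show -1 - p + 1 = -p by ring]
    congr 1
    field_simp
  · filter_upwards [ae_restrict_mem measurableSet_Ioi] with r hr
    exact Real.rpow_nonneg (hc.trans hr).le _

theorem setLIntegral_Ioo_sub_left (G : ℝ → ℝ≥0∞) (s : ℝ) :
    ∫⁻ r in Ioo 0 s, G (s - r) = ∫⁻ u in Ioo 0 s, G u := by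
  rw [← lintegral_indicator measurableSet_Ioo, ← lintegral_indicator measurableSet_Ioo,
    ← lintegral_sub_left_eq_self _ s]
  congr 1 with r
  by_cases h : r ∈ Ioo 0 s
  · rw [indicator_of_mem h, indicator_of_mem (show s - r ∈ Ioo 0 s from
      ⟨by linarith [h.2], by linarith [h.1]⟩), sub_sub_cancel]
  · rw [indicator_of_notMem h, indicator_of_notMem fun h' => h
      ⟨by linarith [h'.2], by linarith [h'.1]⟩]

theorem enorm_mul_rpow_eq {a r p : ℝ} (hr : 0 < r) :
    ‖a * r ^ (-1 - p)‖ₑ = ENNReal.ofReal (|a| / r ^ (1 + p)) := by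
  rw [← ofReal_norm, norm_mul, Real.norm_of_nonneg (Real.rpow_nonneg hr.le _),
    Real.norm_eq_abs, show -1 - p = -(1 + p) by ring, Real.rpow_neg hr.le, div_eq_mul_inv]

theorem enorm_mul_rpow_eq_mul {a r p : ℝ} (hr : 0 < r) :
    ‖a * r ^ (-1 - p)‖ₑ = ENNReal.ofReal |a| * ENNReal.ofReal (r ^ (-1 - p)) := by
  rw [enorm_mul, ← ofReal_norm, ← ofReal_norm, Real.norm_eq_abs,
    Real.norm_of_nonneg (Real.rpow_nonneg hr.le _)]

section Left

variable {T p : ℝ} {f : ℝ → ℝ}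

/-- With f extended by zero, lags r < s give the inner integral of the W₂ norm, and lags r ≥ s give
|f s| ∫_s^∞ r^(-1-p) dr, which is its weighted term divided by p. -/
theorem lintegral_left_kernel_eq (hp : 0 < p) {s : ℝ} (hs : s ∈ Ioc 0 T) :
    ∫⁻ r in Ioi (0 : ℝ), ‖((Ioc 0 T).indicator f s - (Ioc 0 T).indicator f (s - r)) *
        r ^ (-1 - p)‖ₑ =
      (∫⁻ u in Ioc 0 s, ENNReal.ofReal (|f u - f s| / (s - u) ^ (1 + p))) +
        ENNReal.ofReal (1 / p) * ENNReal.ofReal (|f s| / s ^ p) := by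
  have hs0 := hs.1
  rw [← Ioo_union_Ici_eq_Ioi hs.1, lintegral_union measurableSet_Ici
    (by rw [Set.disjoint_left]; intro x hx hx'; exact absurd hx.2 (not_lt.2 hx')),
    setLIntegral_congr (Ioi_ae_eq_Ici (μ := volume) (a := s)).symm]
  congr 1
  · rw [← setLIntegral_congr (Ioo_ae_eq_Ioc (μ := volume) (a := 0) (b := s)),
      ← setLIntegral_Ioo_sub_left fun u => ENNReal.ofReal (|f u - f s| / (s - u) ^ (1 + p))]
    refine setLIntegral_congr_fun measurableSet_Ioo fun r hr => ?_
    have h1 : s - r ∈ Ioc 0 T := ⟨by linarith [hr.2], by linarith [hr.1, hs.2]⟩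
    rw [enorm_mul_rpow_eq hr.1, indicator_of_mem hs, indicator_of_mem h1, abs_sub_comm,
      sub_sub_cancel]
  · have : ∀ r ∈ Ioi s, ‖((Ioc 0 T).indicator f s - (Ioc 0 T).indicator f (s - r)) *
        r ^ (-1 - p)‖ₑ = ENNReal.ofReal |f s| * ENNReal.ofReal (r ^ (-1 - p)) := fun r hr => by
      have h1 : s - r ∉ Ioc 0 T := fun h => absurd h.1 (by linarith [mem_Ioi.1 hr])
      rw [indicator_of_mem hs, indicator_of_notMem h1, sub_zero,
        enorm_mul_rpow_eq_mul (hs0.trans hr)]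
    rw [setLIntegral_congr_fun measurableSet_Ioi this,
      lintegral_const_mul' _ _ ENNReal.ofReal_ne_top, lintegral_Ioi_rpow hp hs0,
      ← ENNReal.ofReal_mul (abs_nonneg _), ← ENNReal.ofReal_mul (by positivity),
      Real.rpow_neg hs0.le]
    congr 1
    field_simp

theorem measurable_left_kernel (hf : Measurable f) (p : ℝ) :
    Measurable fun z : ℝ × ℝ => (f z.1 - f (z.1 - z.2)) * z.2 ^ (-1 - p) := by fun_prop

/-- The `L¹` norm of the left Marchaud derivative kernel. -/
noncomputable def marchaudNorm (T p : ℝ) (f : ℝ → ℝ) : ℝ≥0∞ :=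
  ∫⁻ s in Ioc 0 T, ∫⁻ r in Ioi (0 : ℝ), ‖(f s - f (s - r)) * r ^ (-1 - p)‖ₑ

theorem isMarchaudLeft_of_marchaudNorm_lt_top (hfm : Measurable f) (hfi : Integrable f)
    (hf0 : ∀ s, s ∉ Ioc 0 T → f s = 0) (hN : marchaudNorm T p f < ∞) :
    IsMarchaudLeft T p f where
  measurable := hfm
  integrable := hfi
  eq_zero := hf0
  integrable_kernel := by
    have hm := measurable_left_kernel hfm p
    refine ⟨hm.aestronglyMeasurable, ?_⟩
    rw [HasFiniteIntegral, lintegral_prod _ hm.enorm.aemeasurable]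
    exact hN

theorem MemBesovTwo.isMarchaudLeft (hp : 0 < p) (hf : MemBesovTwo p T f) :
    IsMarchaudLeft T p ((Ioc 0 T).indicator f) := by
  have hm : Measurable ((Ioc 0 T).indicator f) :=
    measurable_indicator_of_domRestrict measurableSet_Icc measurableSet_Ioc
      Ioc_subset_Icc_self hf.1
  have h1 := lt_of_le_of_lt le_self_add hf.2
  have h2 := lt_of_le_of_lt le_add_self hf.2
  refine isMarchaudLeft_of_marchaudNorm_lt_top hm ?_
    (fun s hs => indicator_of_notMem hs _) ?_
  · refine ⟨hm.aestronglyMeasurable, ?_⟩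
    rw [HasFiniteIntegral]
    calc ∫⁻ s, ‖(Ioc 0 T).indicator f s‖ₑ
        = ∫⁻ s in Ioc 0 T, ‖f s‖ₑ := by
          rw [← lintegral_indicator measurableSet_Ioc]
          simp only [enorm_indicator_eq_indicator_enorm]
      _ ≤ ∫⁻ s in Ioc 0 T, ENNReal.ofReal (T ^ p) * ENNReal.ofReal (|f s| / s ^ p) := by
          refine setLIntegral_mono' measurableSet_Ioc fun s hs => ?_
          have hsp : 0 < s ^ p := Real.rpow_pos_of_pos hs.1 p
          rw [← ENNReal.ofReal_mul (Real.rpow_nonneg (hs.1.le.trans hs.2) _), ← ofReal_norm]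
          refine ENNReal.ofReal_le_ofReal ?_
          rw [mul_div_assoc', le_div_iff₀ hsp, mul_comm, Real.norm_eq_abs]
          exact mul_le_mul_of_nonneg_right (Real.rpow_le_rpow hs.1.le hs.2 hp.le) (abs_nonneg _)
      _ < ∞ := by
          rw [lintegral_const_mul' _ _ ENNReal.ofReal_ne_top]
          exact ENNReal.mul_lt_top ENNReal.ofReal_lt_top h1
  · rw [marchaudNorm, setLIntegral_congr_fun measurableSet_Ioc
      fun s hs => lintegral_left_kernel_eq hp hs]
    have hm2 : Measurable fun s : ℝ => (Ioc 0 T).indicator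
        (fun s => ENNReal.ofReal (1 / p) * ENNReal.ofReal (|f s| / s ^ p)) s := by
      have : (fun s : ℝ => (Ioc 0 T).indicator
          (fun s => ENNReal.ofReal (1 / p) * ENNReal.ofReal (|f s| / s ^ p)) s) =
          fun s => ENNReal.ofReal (1 / p) *
            ENNReal.ofReal (|(Ioc 0 T).indicator f s| / s ^ p) := by
        ext s
        by_cases h : s ∈ Ioc 0 T <;> simp [h]
      rw [this]
      fun_prop
    have hm3 : AEMeasurable (fun s => ENNReal.ofReal (1 / p) * ENNReal.ofReal (|f s| / s ^ p))
        (volume.restrict (Ioc 0 T)) :=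
      (aemeasurable_indicator_iff measurableSet_Ioc).1 hm2.aemeasurable
    rw [lintegral_add_right' _ hm3, lintegral_const_mul' _ _ ENNReal.ofReal_ne_top]
    exact ENNReal.add_lt_top.2 ⟨h2, ENNReal.mul_lt_top ENNReal.ofReal_lt_top h1⟩

/-- The boundary term f(s)/s^p is p times the contribution of the lags r ≥ s, where the extended
function vanishes. -/
theorem fracDerivLeft_eq_marchaudLeft (hp0 : 0 < p) {s : ℝ} (hs : s ∈ Ioc 0 T)
    (hi : IntegrableOn (fun r => ((Ioc 0 T).indicator f s - (Ioc 0 T).indicator f (s - r)) *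
      r ^ (-1 - p)) (Ioi 0)) :
    fracDerivLeft p f s =
      p / Real.Gamma (1 - p) * marchaudLeft p ((Ioc 0 T).indicator f) s := by
  have hs0 := hs.1
  have e : marchaudLeft p ((Ioc 0 T).indicator f) s =
      (∫ u in (0 : ℝ)..s, (f s - f u) / (s - u) ^ (p + 1)) + f s * (s ^ (-p) / p) := by
    rw [marchaudLeft]
    rw [← Ioo_union_Ici_eq_Ioi hs.1] at hi ⊢
    rw [setIntegral_union (by
      rw [Set.disjoint_left]; intro x hx hx'; exact absurd hx.2 (not_lt.2 hx')) measurableSet_Ici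
      hi.left_of_union hi.right_of_union]
    congr 1
    · have h1 := intervalIntegral.integral_comp_sub_left
        (fun u => (f s - f u) / (s - u) ^ (p + 1)) s (a := 0) (b := s)
      rw [sub_self, sub_zero] at h1
      rw [← h1, intervalIntegral.integral_of_le hs0.le, integral_Ioc_eq_integral_Ioo]
      refine setIntegral_congr_fun measurableSet_Ioo fun r hr => ?_
      have h2 : s - r ∈ Ioc 0 T := ⟨by linarith [hr.2], by linarith [hr.1, hs.2]⟩
      rw [indicator_of_mem hs, indicator_of_mem h2, sub_sub_cancel,
        show -1 - p = -(p + 1) by ring, Real.rpow_neg hr.1.le, div_eq_mul_inv]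
    · have : ∀ r ∈ Ici s, ((Ioc 0 T).indicator f s - (Ioc 0 T).indicator f (s - r)) *
          r ^ (-1 - p) = f s * r ^ (-1 - p) := fun r hr => by
        have h1 : s - r ∉ Ioc 0 T := fun h => absurd h.1 (by linarith [mem_Ici.1 hr])
        rw [indicator_of_mem hs, indicator_of_notMem h1, sub_zero]
      rw [setIntegral_congr_fun measurableSet_Ici this, integral_const_mul,
        integral_Ici_eq_integral_Ioi, integral_Ioi_rpow_of_lt (by linarith) hs0,
        show -1 - p + 1 = -p by ring]
      congr 1
      field_simp
  rw [e, fracDerivLeft, Real.rpow_neg hs0.le]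
  field_simp
  ring

theorem IsMarchaudLeft.ae_integrableOn (hf : IsMarchaudLeft T p f) :
    ∀ᵐ s ∂(volume.restrict (Ioc 0 T)),
      IntegrableOn (fun r => (f s - f (s - r)) * r ^ (-1 - p)) (Ioi 0) :=
  hf.integrable_kernel.prod_right_ae

end Left

section Right

variable {T p : ℝ} {g : ℝ → ℝ}

/-- The increment `g - g T` on `[0, T]`, extended by zero. -/
noncomputable def terminalIncrement (T : ℝ) (g : ℝ → ℝ) : ℝ → ℝ :=
  (Icc 0 T).indicator fun s => g s - g T

theorem terminalIncrement_of_mem {s : ℝ} (hs : s ∈ Icc 0 T) :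
    terminalIncrement T g s = g s - g T := indicator_of_mem hs _

theorem terminalIncrement_of_ge {s : ℝ} (hs : T ≤ s) : terminalIncrement T g s = 0 := by
  by_cases h : s ∈ Icc 0 T
  · rw [terminalIncrement_of_mem h, le_antisymm h.2 hs, sub_self]
  · exact indicator_of_notMem h _

theorem MemBesovOne.exists_bound (hg : MemBesovOne p T g) :
    ∃ C : ℝ, 0 ≤ C ∧ (∀ s t, 0 ≤ s → s < t → t ≤ T → |g t - g s| ≤ C * (t - s) ^ p) ∧
      ∀ s t, 0 ≤ s → s < t → t ≤ T →
        ∫⁻ u in Ioc s t, ENNReal.ofReal (|g u - g s| / (u - s) ^ (1 + p)) ≤ ENNReal.ofReal C := by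
  obtain ⟨-, h⟩ := hg
  set S := ⨆ (s : ℝ) (t : ℝ) (_ : 0 ≤ s ∧ s < t ∧ t ≤ T),
      (ENNReal.ofReal (|g t - g s| / (t - s) ^ p) +
        ∫⁻ u in Ioc s t, ENNReal.ofReal (|g u - g s| / (u - s) ^ (1 + p))) with hS
  have hle : ∀ s t, 0 ≤ s → s < t → t ≤ T → (ENNReal.ofReal (|g t - g s| / (t - s) ^ p) +
        ∫⁻ u in Ioc s t, ENNReal.ofReal (|g u - g s| / (u - s) ^ (1 + p))) ≤ S :=
    fun s t h1 h2 h3 => le_iSup_of_le s (le_iSup_of_le t (le_iSup_of_le ⟨h1, h2, h3⟩ le_rfl))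
  have hSr : ENNReal.ofReal S.toReal = S := ENNReal.ofReal_toReal h.ne
  refine ⟨S.toReal, ENNReal.toReal_nonneg, fun s t h1 h2 h3 => ?_, fun s t h1 h2 h3 => ?_⟩
  · have h4 := le_self_add.trans (hle s t h1 h2 h3)
    rw [← hSr, ENNReal.ofReal_le_ofReal_iff ENNReal.toReal_nonneg,
      div_le_iff₀ (Real.rpow_pos_of_pos (by linarith) _)] at h4
    exact h4
  · rw [hSr]
    exact le_add_self.trans (hle s t h1 h2 h3)

/-- The first term of the W₁ norm forces Hölder continuity of order p up to T. Subtracting g(T-) is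
therefore the same as subtracting g(T), as `terminalIncrement` does. -/
theorem MemBesovOne.leftLim_eq (hT : 0 < T) (hp : 0 < p) (hg : MemBesovOne p T g) :
    Function.leftLim g T = g T := by
  obtain ⟨C, hC, h1, -⟩ := hg.exists_bound
  refine leftLim_eq_of_tendsto ?_
  rw [tendsto_iff_norm_sub_tendsto_zero]
  have h2 : Tendsto (fun s : ℝ => C * (T - s) ^ p) (𝓝[<] T) (𝓝 0) := by
    have : ContinuousAt (fun s : ℝ => C * (T - s) ^ p) T := by
      have := (Real.continuousAt_rpow_const (T - T) p (Or.inr hp.le)).comp (f := fun s : ℝ => T - s)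
        (x := T) (by fun_prop)
      exact continuousAt_const.mul this
    have h3 := this.tendsto.mono_left (nhdsWithin_le_nhds (s := Iio T))
    simpa [hp.ne'] using h3
  refine tendsto_of_tendsto_of_tendsto_of_le_of_le' tendsto_const_nhds h2
    (Eventually.of_forall fun _ => norm_nonneg _) ?_
  filter_upwards [Ioo_mem_nhdsLT hT] with s hs
  rw [norm_sub_rev]
  exact h1 s T hs.1.le hs.2 le_rfl

theorem MemBesovOne.isTameMarchaud (hT : 0 < T) (hp : 0 < p) (hg : MemBesovOne p T g) :
    ∃ B A, IsTameMarchaud T B p A (terminalIncrement T g) := by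
  obtain ⟨C, hC, h1, h2⟩ := hg.exists_bound
  have hb : ∀ s, 0 ≤ s → s < T → |terminalIncrement T g s| ≤ C * (T - s) ^ p := fun s hs hsT => by
    rw [terminalIncrement_of_mem ⟨hs, hsT.le⟩, abs_sub_comm]
    exact h1 s T hs hsT le_rfl
  -- In the derivative bound, C comes from lags staying in [0, T] and is the Besov integral. The
  -- part C/p comes from longer lags, where |g s - g T| ≤ C (T-s)^p cancels the tail (T-s)^(-p)/p.
  refine ⟨C * T ^ p, C + C / p, ⟨?_, ?_, fun s hs => terminalIncrement_of_ge hs.le⟩, by positivity,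
    fun s hs => ?_⟩
  · refine measurable_indicator_of_domRestrict measurableSet_Icc measurableSet_Icc subset_rfl ?_
    exact hg.1.sub_const (g T)
  · intro s hs
    rcases lt_or_ge s T with h | h
    · refine (hb s hs h).trans ?_
      gcongr
      linarith
    · rw [terminalIncrement_of_ge h, abs_zero]
      positivity
  · rcases lt_or_ge s T with h | h
    · have hsT : 0 < T - s := by linarith
      rw [← Ioc_union_Ioi_eq_Ioi hsT.le, lintegral_union measurableSet_Ioi Ioc_disjoint_Ioi_same,
        ENNReal.ofReal_add hC (by positivity)]
      gcongr
      · refine le_trans (le_of_eq ?_) (h2 s T hs h le_rfl)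
        rw [← lintegral_indicator measurableSet_Ioc, ← lintegral_indicator measurableSet_Ioc,
          ← lintegral_add_left_eq_self ((Ioc s T).indicator fun u =>
            ENNReal.ofReal (|g u - g s| / (u - s) ^ (1 + p))) s]
        congr 1 with q
        by_cases hq : q ∈ Ioc 0 (T - s)
        · have hq' : s + q ∈ Ioc s T := ⟨by linarith [hq.1], by linarith [hq.2]⟩
          rw [indicator_of_mem hq, indicator_of_mem hq', enorm_mul_rpow_eq hq.1,
            terminalIncrement_of_mem ⟨hs, h.le⟩, terminalIncrement_of_mem
              ⟨hs.trans hq'.1.le, hq'.2⟩, sub_sub_sub_cancel_right, abs_sub_comm, add_sub_cancel_left]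
        · rw [indicator_of_notMem hq, indicator_of_notMem fun hq' : s + q ∈ Ioc s T => hq
            ⟨by linarith [hq'.1], by linarith [hq'.2]⟩]
      · have : ∀ q ∈ Ioi (T - s), ‖(terminalIncrement T g s - terminalIncrement T g (s + q)) *
            q ^ (-1 - p)‖ₑ = ENNReal.ofReal |terminalIncrement T g s| *
              ENNReal.ofReal (q ^ (-1 - p)) := fun q hq => by
          have hq : T - s < q := hq
          rw [terminalIncrement_of_ge (s := s + q) (by linarith), sub_zero,
            enorm_mul_rpow_eq_mul (hsT.trans hq)]
        rw [setLIntegral_congr_fun measurableSet_Ioi this,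
          lintegral_const_mul' _ _ ENNReal.ofReal_ne_top, lintegral_Ioi_rpow hp hsT,
          ← ENNReal.ofReal_mul (abs_nonneg _)]
        refine ENNReal.ofReal_le_ofReal ?_
        have hpos := Real.rpow_pos_of_pos hsT p
        calc |terminalIncrement T g s| * ((T - s) ^ (-p) / p)
            ≤ C * (T - s) ^ p * ((T - s) ^ (-p) / p) := by
              gcongr
              exact hb s hs h
          _ = C / p := by
              rw [Real.rpow_neg hsT.le]; field_simp
    · refine le_trans (le_of_eq ?_) (zero_le)
      refine (setLIntegral_congr_fun measurableSet_Ioi fun q hq => ?_).trans lintegral_zero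
      rw [terminalIncrement_of_ge h, terminalIncrement_of_ge (by linarith [mem_Ioi.1 hq]),
        sub_zero, zero_mul, enorm_zero]

theorem fracDerivRight_eq_marchaudRight (hp0 : 0 < p) {s : ℝ} (hs : s ∈ Ico 0 T) {B A : ℝ}
    (hh : IsTameMarchaud T B p A (terminalIncrement T g)) :
    fracDerivRight p T (fun r => g r - g T) s =
      p / Real.Gamma (1 - p) * marchaudRight p (terminalIncrement T g) s := by
  have hsT : 0 < T - s := by linarith [hs.2]
  have hi := hh.integrableOn hs.1
  have hmem : terminalIncrement T g s = g s - g T := terminalIncrement_of_mem ⟨hs.1, hs.2.le⟩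
  have e : marchaudRight p (terminalIncrement T g) s =
      (∫ u in s..T, (g s - g T - (g u - g T)) / (u - s) ^ (p + 1)) +
        (g s - g T) * ((T - s) ^ (-p) / p) := by
    rw [marchaudRight]
    rw [← Ioc_union_Ioi_eq_Ioi hsT.le] at hi ⊢
    rw [setIntegral_union Ioc_disjoint_Ioi_same measurableSet_Ioi
      hi.left_of_union hi.right_of_union]
    congr 1
    · have h1 := intervalIntegral.integral_comp_add_left
        (fun u => (g s - g T - (g u - g T)) / (u - s) ^ (p + 1)) s (a := 0) (b := T - s)
      rw [add_zero, add_sub_cancel] at h1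
      rw [← h1, intervalIntegral.integral_of_le hsT.le]
      refine setIntegral_congr_fun measurableSet_Ioc fun q hq => ?_
      rw [hmem, terminalIncrement_of_mem ⟨by linarith [hs.1, hq.1], by linarith [hq.2]⟩,
        add_sub_cancel_left,
        show -1 - p = -(p + 1) by ring, Real.rpow_neg hq.1.le, div_eq_mul_inv]
    · have : ∀ q ∈ Ioi (T - s), (terminalIncrement T g s - terminalIncrement T g (s + q)) *
          q ^ (-1 - p) = (g s - g T) * q ^ (-1 - p) := fun q hq => by
        rw [terminalIncrement_of_ge (s := s + q) (by linarith [mem_Ioi.1 hq]), sub_zero, hmem]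
      rw [setIntegral_congr_fun measurableSet_Ioi this, integral_const_mul,
        integral_Ioi_rpow_of_lt (by linarith) hsT, show -1 - p + 1 = -p by ring]
      congr 1
      field_simp
  rw [e, fracDerivRight, Real.rpow_neg hsT.le]
  field_simp
  ring

end Right

/-! ### The integral as a limit of integrals against averaged integrators -/

section Integral

variable {T p : ℝ} {f g : ℝ → ℝ}

/-- The constant is the product of the normalisations p/Γ(1-p) and (1-p)/Γ(p). Null sets are lost
because the left kernel converges only for almost every s and the right identity needs s < T. -/
theorem GLSAdmissible.glsIntegrand_ae_eq (hT : 0 < T) (h : GLSAdmissible p T f g) :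
    (fun s => -(p * (1 - p) / (Real.Gamma p * Real.Gamma (1 - p))) *
      (marchaudLeft p ((Ioc 0 T).indicator f) s *
        marchaudRight (1 - p) (terminalIncrement T g) s))
      =ᵐ[volume.restrict (Ioc 0 T)] glsIntegrand p T f g := by
  obtain ⟨hp0, hp1, hf, hg⟩ := h
  obtain ⟨B, A, hh⟩ := hg.isTameMarchaud hT (by linarith)
  filter_upwards [(hf.isMarchaudLeft hp0).ae_integrableOn, ae_restrict_mem measurableSet_Ioc,
    ae_restrict_of_ae (compl_mem_ae_iff.2 (measure_singleton T))] with s hs hsm hsT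
  have hsT : s < T := lt_of_le_of_ne hsm.2 hsT
  rw [glsIntegrand, hg.leftLim_eq hT (by linarith), fracDerivLeft_eq_marchaudLeft hp0 hsm hs,
    fracDerivRight_eq_marchaudRight (by linarith) ⟨hsm.1.le, hsT⟩ hh, sub_sub_cancel]
  have := Real.Gamma_pos_of_pos hp0
  have := Real.Gamma_pos_of_pos (show 0 < 1 - p by linarith)
  field_simp

theorem IsMarchaudLeft.integrableOn_mul {B A q : ℝ} {h : ℝ → ℝ} (hf : IsMarchaudLeft T p f)
    (hh : IsTameMarchaud T B q A h) :
    IntegrableOn (fun s => marchaudLeft p f s * marchaudRight q h s) (Ioc 0 T) := by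
  refine hf.integrableOn_marchaudLeft.mul_bdd (c := A)
    hh.marchaudRight.measurable.aestronglyMeasurable ?_
  filter_upwards [ae_restrict_mem measurableSet_Ioc] with s hs
  exact hh.marchaudRight.abs_le s hs.1.le

theorem GLSAdmissible.intervalIntegrable (hT : 0 < T) (h : GLSAdmissible p T f g) :
    IntervalIntegrable (glsIntegrand p T f g) volume 0 T := by
  obtain ⟨B, A, hh⟩ := h.2.2.2.isTameMarchaud hT (by linarith [h.2.1])
  rw [intervalIntegrable_iff_integrableOn_Ioc_of_le hT.le]
  exact Integrable.congr (((h.2.2.1.isMarchaudLeft h.1).integrableOn_mul hh).const_mul _)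
    (h.glsIntegrand_ae_eq hT)

theorem GLSAdmissible.integral_eq (hT : 0 < T) (h : GLSAdmissible p T f g) :
    ∫ s in (0 : ℝ)..T, glsIntegrand p T f g s =
      -(p * (1 - p) / (Real.Gamma p * Real.Gamma (1 - p)) *
        ∫ s in Ioc 0 T, marchaudLeft p ((Ioc 0 T).indicator f) s *
          marchaudRight (1 - p) (terminalIncrement T g) s) := by
  rw [intervalIntegral.integral_of_le hT.le, ← integral_congr_ae (h.glsIntegrand_ae_eq hT),
    integral_const_mul, neg_mul]

/-- The integral of `f` against the second difference quotient of a mollification of `g`. -/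
noncomputable def forwardIntegral (T : ℝ) (h f : ℝ → ℝ) (ε : ℝ) : ℝ :=
  -(ε⁻¹ ^ 2 * ∫ s in Ioc 0 T, f s *
    weylInt 0 (fun s => (h s - h (s + ε)) - (h (s + ε) - h (s + ε + ε))) s)

/-- The approximants do not involve p, so uniqueness of limits makes the integrals of all admissible
orders agree. -/
theorem GLSAdmissible.tendsto_forwardIntegral (hT : 0 < T) (h : GLSAdmissible p T f g) :
    Tendsto (forwardIntegral T (terminalIncrement T g) ((Ioc 0 T).indicator f)) (𝓝[>] 0)
      (𝓝 (∫ s in (0 : ℝ)..T, glsIntegrand p T f g s)) := by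
  obtain ⟨B, A, hh⟩ := h.2.2.2.isTameMarchaud hT (by linarith [h.2.1])
  rw [h.integral_eq hT]
  exact ((h.2.2.1.isMarchaudLeft h.1).tendsto_integral_mul_weylInt hT h.1 h.2.1 hh).neg

end Integral

section ForwardIntegral

variable {T p B A : ℝ} {f g h : ℝ → ℝ}

theorem IsTame.integrableOn_mul_weylInt (hh : IsTame T B h) {ε : ℝ} (hε : 0 ≤ ε)
    (hf : IntegrableOn f (Ioc 0 T)) :
    IntegrableOn (fun s => f s * _root_.weylInt 0
      (fun s => (h s - h (s + ε)) - (h (s + ε) - h (s + ε + ε))) s) (Ioc 0 T) := by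
  have hw := ((hh.sub_comp_add hε).sub_comp_add hε).weylInt (p := 0) one_pos
  exact hf.mul_bdd hw.measurable.aestronglyMeasurable
    ((ae_restrict_mem measurableSet_Ioc).mono fun s hs => hw.abs_le s hs.1.le)

theorem IsTame.forwardIntegral_sum (hh : IsTame T B h) {ε : ℝ} (hε : 0 ≤ ε) {ι : Type*}
    (J : Finset ι) (F : ι → ℝ → ℝ) (hF : ∀ i ∈ J, IntegrableOn (F i) (Ioc 0 T)) :
    forwardIntegral T h (fun s => ∑ i ∈ J, F i s) ε = ∑ i ∈ J, forwardIntegral T h (F i) ε := by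
  simp only [forwardIntegral, Finset.sum_mul]
  rw [integral_finsetSum _ fun i hi => hh.integrableOn_mul_weylInt hε (hF i hi),
    Finset.mul_sum, Finset.sum_neg_distrib]

theorem IsTame.forwardIntegral_add (hh : IsTame T B h) {ε : ℝ} (hε : 0 ≤ ε) {F G : ℝ → ℝ}
    (hF : IntegrableOn F (Ioc 0 T)) (hG : IntegrableOn G (Ioc 0 T)) :
    forwardIntegral T h (fun s => F s + G s) ε =
      forwardIntegral T h F ε + forwardIntegral T h G ε := by
  simp only [forwardIntegral, add_mul]
  rw [integral_add (hh.integrableOn_mul_weylInt hε hF) (hh.integrableOn_mul_weylInt hε hG)]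
  ring

theorem forwardIntegral_const_mul (c ε : ℝ) :
    forwardIntegral T h (fun s => c * f s) ε = c * forwardIntegral T h f ε := by
  simp only [forwardIntegral, mul_assoc, integral_const_mul]
  ring

theorem IsTame.tendsto_movingInt (hh : IsTame T B h) {s : ℝ} (hs : 0 ≤ s)
    (hc : Tendsto (fun z => h (s + z)) (𝓝[≥] 0) (𝓝 (h s))) :
    Tendsto (fun ε => ε⁻¹ ^ 2 * _root_.movingInt ε (_root_.movingInt ε h) s) (𝓝[>] 0)
      (𝓝 (h s)) := by
  have := tendsto_double_average (c := fun z => h (s + z)) (M := B)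
    (by have := hh.measurable; fun_prop) (fun z hz => hh.abs_le _ (by linarith)) hc
  simpa only [_root_.movingInt, add_assoc] using this

/-- Against an indicator the approximant is exactly the increment of the normalised double average
of h, which converges by right continuity at both endpoints. -/
theorem IsTame.tendsto_forwardIntegral_indicator (hh : IsTame T B h) {c d : ℝ} (hc : 0 ≤ c)
    (hcd : c ≤ d) (hd : d ≤ T)
    (hr : ∀ s ∈ Icc 0 T, Tendsto (fun z => h (s + z)) (𝓝[≥] 0) (𝓝 (h s))) :
    Tendsto (forwardIntegral T h ((Ioc c d).indicator 1)) (𝓝[>] 0) (𝓝 (h d - h c)) := by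
  refine ((hh.tendsto_movingInt (hc.trans hcd) (hr d ⟨hc.trans hcd, hd⟩)).sub
    (hh.tendsto_movingInt hc (hr c ⟨hc, hcd.trans hd⟩))).congr' ?_
  filter_upwards [self_mem_nhdsWithin] with ε hε
  have hε : 0 ≤ ε := le_of_lt hε
  set w : ℝ → ℝ := fun s => (h s - h (s + ε)) - (h (s + ε) - h (s + ε + ε)) with hw
  have hwt : IsTame T _ (_root_.weylInt 0 w) :=
    ((hh.sub_comp_add hε).sub_comp_add hε).weylInt (p := 0) one_pos
  have h1 := weylInt_zero_sub hwt hc (sub_nonneg.2 hcd)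
  rw [add_sub_cancel, hh.weylInt_zero_weylInt_zero hε hc,
    hh.weylInt_zero_weylInt_zero hε (hc.trans hcd)] at h1
  have h2 : ∫ s in Ioc 0 T, (Ioc c d).indicator 1 s * _root_.weylInt 0 w s =
      ∫ x in Ioc 0 (d - c), _root_.weylInt 0 w (c + x) := by
    rw [← integral_indicator measurableSet_Ioc, ← integral_indicator measurableSet_Ioc,
      ← integral_add_left_eq_self _ c]
    congr 1 with x
    by_cases hx : x ∈ Ioc 0 (d - c)
    · have h3 : c + x ∈ Ioc c d := ⟨by linarith [hx.1], by linarith [hx.2]⟩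
      have h4 : c + x ∈ Ioc 0 T := ⟨by linarith [hx.1], by linarith [hx.2]⟩
      rw [indicator_of_mem hx, indicator_of_mem h4, indicator_of_mem h3, Pi.one_apply, one_mul]
    · have h3 : c + x ∉ Ioc c d := fun h3 => hx ⟨by linarith [h3.1], by linarith [h3.2]⟩
      rw [indicator_of_notMem hx]
      simp [indicator_of_notMem h3]
  rw [forwardIntegral, h2, ← h1]
  ring

theorem MemBesovOne.tendsto_terminalIncrement (hp : 0 < p) (hg : MemBesovOne p T g) :
    ∀ s ∈ Icc 0 T, Tendsto (fun z => terminalIncrement T g (s + z)) (𝓝[≥] 0)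
      (𝓝 (terminalIncrement T g s)) := by
  obtain ⟨C, hC, h1, -⟩ := hg.exists_bound
  intro s hs
  rcases hs.2.lt_or_eq with hsT | rfl
  · rw [tendsto_iff_norm_sub_tendsto_zero]
    have h2 : Tendsto (fun z : ℝ => C * z ^ p) (𝓝[≥] 0) (𝓝 0) := by
      have : ContinuousAt (fun z : ℝ => C * z ^ p) 0 :=
        continuousAt_const.mul (Real.continuousAt_rpow_const 0 p (Or.inr hp.le))
      have h3 := this.tendsto.mono_left (nhdsWithin_le_nhds (s := Ici 0))
      simpa [hp.ne'] using h3
    refine tendsto_of_tendsto_of_tendsto_of_le_of_le' tendsto_const_nhds h2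
      (Eventually.of_forall fun _ => norm_nonneg _) ?_
    filter_upwards [Ico_mem_nhdsGE (show (0 : ℝ) < T - s by linarith)] with z hz
    rcases hz.1.lt_or_eq with h0 | rfl
    · have h4 : s + z ∈ Icc 0 T := ⟨by linarith [hs.1], by linarith [hz.2]⟩
      rw [terminalIncrement_of_mem h4, terminalIncrement_of_mem hs, sub_sub_sub_cancel_right]
      simpa using h1 s (s + z) hs.1 (by linarith) h4.2
    · simp [hp.ne']
  · refine Tendsto.congr' (f₁ := fun _ => 0) ?_ ?_
    · filter_upwards [self_mem_nhdsWithin] with z hz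
      exact (terminalIncrement_of_ge (by linarith [mem_Ici.1 hz])).symm
    · rw [terminalIncrement_of_ge le_rfl]
      exact tendsto_const_nhds

/-- This is the L¹–L^∞ pairing: the right derivative is uniformly bounded, and the left one is
dominated by its absolute kernel. -/
theorem IsTameMarchaud.abs_integral_mul_le {q : ℝ} (f : ℝ → ℝ)
    (hh : IsTameMarchaud T B q A h) :
    ENNReal.ofReal |∫ s in Ioc 0 T, marchaudLeft p f s * _root_.marchaudRight q h s| ≤
      ENNReal.ofReal A * marchaudNorm T p f := by
  rw [← Real.norm_eq_abs, ofReal_norm, marchaudNorm,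
    ← lintegral_const_mul' _ _ ENNReal.ofReal_ne_top]
  refine (enorm_integral_le_lintegral_enorm _).trans
    (setLIntegral_mono' measurableSet_Ioc fun s hs => ?_)
  rw [enorm_mul, mul_comm]
  refine mul_le_mul' ?_ (enorm_integral_le_lintegral_enorm _)
  rw [← ofReal_norm]
  exact ENNReal.ofReal_le_ofReal (hh.marchaudRight.abs_le s hs.1.le)

end ForwardIntegral

/-! ### Riemann–Stieltjes sums -/

theorem Fin.sum_succ_sub_castSucc {M : Type*} [AddCommGroup M] :
    ∀ {k : ℕ} (a : Fin (k + 1) → M),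
      ∑ i : Fin k, (a i.succ - a i.castSucc) = a (Fin.last k) - a 0
  | 0, a => by simp
  | k + 1, a => by
    rw [Fin.sum_univ_castSucc]
    have := Fin.sum_succ_sub_castSucc (fun i : Fin (k + 1) => a i.castSucc)
    simp only [← Fin.succ_castSucc] at this ⊢
    rw [this]
    simp

namespace TaggedPartition

variable {T : ℝ}

/-- The cell `(t_{i-1}, t_i]`. -/
def cell (π : TaggedPartition T) (i : Fin π.k) : Set ℝ := Ioc (π.pt i.castSucc) (π.pt i.succ)

/-- The deviation of `f` on a cell from its value at the tag. -/
noncomputable def deviation (π : TaggedPartition T) (f : ℝ → ℝ) (i : Fin π.k) : ℝ → ℝ :=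
  (π.cell i).indicator fun s => f s - f (π.tag i)

theorem pt_nonneg (π : TaggedPartition T) (i : Fin (π.k + 1)) : 0 ≤ π.pt i := by
  rw [← π.pt_zero]; exact π.strictMono_pt.monotone (Fin.zero_le i)

theorem pt_le (π : TaggedPartition T) (i : Fin (π.k + 1)) : π.pt i ≤ T :=
  (π.strictMono_pt.monotone (Fin.le_last i)).trans_eq π.pt_last

theorem pt_lt (π : TaggedPartition T) (i : Fin π.k) : π.pt i.castSucc < π.pt i.succ :=
  π.strictMono_pt i.castSucc_lt_succ

theorem cell_subset (π : TaggedPartition T) (i : Fin π.k) : π.cell i ⊆ Ioc 0 T :=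
  Ioc_subset_Ioc (π.pt_nonneg _) (π.pt_le _)

/-- Each cell is a difference of half-lines, so the sum telescopes. -/
theorem sum_indicator_cell (π : TaggedPartition T) (f : ℝ → ℝ) (s : ℝ) :
    ∑ i, (π.cell i).indicator f s = (Ioc 0 T).indicator f s := by
  have e : ∀ a b : ℝ, a ≤ b →
      (Ioc a b).indicator f s = (Iic b).indicator f s - (Iic a).indicator f s := fun a b hab => by
    by_cases h1 : s ≤ a
    · simp [h1, h1.trans hab, h1.not_gt]
    · by_cases h2 : s ≤ b <;> simp [h1, h2, lt_of_not_ge h1]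
  have h0 := Fin.sum_succ_sub_castSucc fun i : Fin (π.k + 1) => (Iic (π.pt i)).indicator f s
  have hT : (0 : ℝ) ≤ T := (π.pt_nonneg (Fin.last _)).trans_eq π.pt_last
  rw [e 0 T hT]
  rw [π.pt_zero, π.pt_last] at h0
  rw [← h0]
  exact Finset.sum_congr rfl fun i _ => e _ _ (π.pt_lt i).le

theorem sum_lintegral_cell_le (π : TaggedPartition T) (F : ℝ → ℝ≥0∞) :
    ∑ i, ∫⁻ s in π.cell i, F s ≤ ∫⁻ s in Ioc 0 T, F s := by
  have hd : Pairwise (Function.onFun Disjoint π.cell) := by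
    have key : ∀ i j : Fin π.k, i < j → Disjoint (π.cell i) (π.cell j) := fun i j hij => by
      rw [Set.disjoint_left]
      intro s hs hs'
      have : π.pt i.succ ≤ π.pt j.castSucc :=
        π.strictMono_pt.monotone (Fin.succ_le_castSucc_iff.2 hij)
      exact absurd hs'.1 (not_lt.2 (hs.2.trans this))
    intro i j hij
    rcases lt_or_gt_of_ne hij with h | h
    · exact key i j h
    · exact (key j i h).symm
  have h1 := lintegral_iUnion (μ := volume) (s := π.cell) (fun i => measurableSet_Ioc) hd F
  rw [tsum_fintype] at h1
  rw [← h1]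
  exact lintegral_mono_set (iUnion_subset π.cell_subset)

theorem sub_le_mesh (π : TaggedPartition T) (i : Fin π.k) :
    π.pt i.succ - π.pt i.castSucc ≤ π.mesh :=
  le_ciSup (f := fun i : Fin π.k => π.pt i.succ - π.pt i.castSucc) (Set.finite_range _).bddAbove i

/-- Distance between the generalized Lebesgue–Stieltjes integral and a Riemann–Stieltjes sum. -/
theorem exists_abs_integral_sub_rsSum_le {p : ℝ} {f g : ℝ → ℝ} (hT : 0 < T)
    (h : GLSAdmissible p T f g) :
    ∃ K : ℝ≥0∞, K ≠ ∞ ∧ ∀ π : TaggedPartition T, (∀ i, IsMarchaudLeft T p (π.deviation f i)) →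
      ENNReal.ofReal |π.rsSum f g - ∫ s in (0 : ℝ)..T, glsIntegrand p T f g s| ≤
        K * ∑ i, marchaudNorm T p (π.deviation f i) := by
  have hp0 := h.1
  have hp1 := h.2.1
  obtain ⟨B, A, hh⟩ := h.2.2.2.isTameMarchaud hT (by linarith)
  have hr := h.2.2.2.tendsto_terminalIncrement (by linarith)
  set κ := p * (1 - p) / (Real.Gamma p * Real.Gamma (1 - p)) with hκ
  set H := terminalIncrement T g
  refine ⟨ENNReal.ofReal |κ| * ENNReal.ofReal A,
    ENNReal.mul_ne_top ENNReal.ofReal_ne_top ENNReal.ofReal_ne_top, fun π hπ => ?_⟩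
  -- `E i` is minus the integral of the deviation on the cell, so the error of the Riemann–Stieltjes
  -- sum is the sum of the `E i`.
  set E : Fin π.k → ℝ := fun i =>
    κ * ∫ s in Ioc 0 T, marchaudLeft p (π.deviation f i) s * marchaudRight (1 - p) H s with hE
  have hone : ∀ i, IntegrableOn ((π.cell i).indicator (1 : ℝ → ℝ)) (Ioc 0 T) := fun i =>
    (integrable_indicator_iff measurableSet_Ioc).2
      (by simp [Pi.one_def]) |>.integrableOn
  have hterm : ∀ i, Tendsto (fun ε => forwardIntegral T H (π.deviation f i) ε +
      f (π.tag i) * forwardIntegral T H ((π.cell i).indicator 1) ε) (𝓝[>] 0)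
      (𝓝 (-E i + f (π.tag i) * (g (π.pt i.succ) - g (π.pt i.castSucc)))) := fun i => by
    refine ((hπ i).tendsto_integral_mul_weylInt hT hp0 hp1 hh).neg.add (Tendsto.const_mul _ ?_)
    have := hh.tame.tendsto_forwardIntegral_indicator (π.pt_nonneg _) (π.pt_lt i).le (π.pt_le _) hr
    rwa [show H (π.pt i.succ) = _ from terminalIncrement_of_mem ⟨π.pt_nonneg _, π.pt_le _⟩,
      show H (π.pt i.castSucc) = _ from terminalIncrement_of_mem ⟨π.pt_nonneg _, π.pt_le _⟩, sub_sub_sub_cancel_right] at this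
  have hsum := tendsto_finsetSum Finset.univ fun i _ => hterm i
  have heq : (fun ε => ∑ i, (forwardIntegral T H (π.deviation f i) ε +
      f (π.tag i) * forwardIntegral T H ((π.cell i).indicator 1) ε)) =ᶠ[𝓝[>] 0]
      forwardIntegral T H ((Ioc 0 T).indicator f) := by
    filter_upwards [self_mem_nhdsWithin] with ε hε
    have hε : 0 ≤ ε := le_of_lt hε
    have e1 : (Ioc 0 T).indicator f = fun s => ∑ i, (π.deviation f i s +
        f (π.tag i) * (π.cell i).indicator 1 s) := by
      ext s
      rw [← π.sum_indicator_cell]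
      refine Finset.sum_congr rfl fun i _ => ?_
      by_cases hs : s ∈ π.cell i <;> simp [deviation, hs]
    rw [e1, hh.tame.forwardIntegral_sum hε Finset.univ
      (fun i s => π.deviation f i s + f (π.tag i) * (π.cell i).indicator 1 s) fun i _ =>
      (hπ i).integrable.integrableOn.add ((hone i).const_mul _)]
    refine Finset.sum_congr rfl fun i _ => ?_
    rw [hh.tame.forwardIntegral_add hε (hπ i).integrable.integrableOn ((hone i).const_mul _),
      forwardIntegral_const_mul]
  -- The approximants of f converge both termwise, over its splitting into deviations and step
  -- functions, and as a whole to the integral.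
  have hlim := tendsto_nhds_unique (hsum.congr' heq) (h.tendsto_forwardIntegral hT)
  rw [Finset.sum_add_distrib, Finset.sum_neg_distrib] at hlim
  have h1 : π.rsSum f g - ∫ s in (0 : ℝ)..T, glsIntegrand p T f g s = ∑ i, E i := by
    rw [← hlim, rsSum]; ring
  rw [h1, Finset.mul_sum]
  refine (ENNReal.ofReal_le_ofReal (Finset.abs_sum_le_sum_abs _ _)).trans ?_
  rw [ENNReal.ofReal_sum_of_nonneg fun i _ => abs_nonneg _]
  refine Finset.sum_le_sum fun i _ => ?_
  rw [hE, abs_mul, ENNReal.ofReal_mul (abs_nonneg _), mul_assoc]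
  gcongr
  exact hh.abs_integral_mul_le _

end TaggedPartition

/-! ### Pathwise estimates by Riesz potentials -/

/-- The Riesz potential at `y` of the restriction of `ν` to a ball. -/
noncomputable def localPotential (ν : Measure ℝ) (κ ρ y : ℝ) : ℝ≥0∞ :=
  ∫⁻ b in {b | |y - b| ≤ ρ}, ENNReal.ofReal |y - b| ^ (-κ) ∂ν

theorem localPotential_mono (ν : Measure ℝ) (κ y : ℝ) {ρ ρ' : ℝ} (h : ρ ≤ ρ') :
    localPotential ν κ ρ y ≤ localPotential ν κ ρ' y :=
  lintegral_mono_set fun _ hb => le_trans hb h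

theorem measurableSet_abs_sub_le (y ρ : ℝ) : MeasurableSet {b : ℝ | |y - b| ≤ ρ} :=
  measurableSet_le (by fun_prop) measurable_const

/-- A path `f` dominated by the `ν`-variation along a Hölder path `x`. -/
structure IsHolderDominated (T C a : ℝ) (ν : Measure ℝ) (x f : ℝ → ℝ) : Prop where
  pos_T : 0 < T
  pos_C : 0 < C
  pos_a : 0 < a
  holder : ∀ s ∈ Icc 0 T, ∀ t ∈ Icc 0 T, |x s - x t| ≤ C * |s - t| ^ a
  measurable : Measurable ((Icc 0 T).domRestrict f)
  le : ∀ s ∈ Icc 0 T, ∀ t ∈ Icc 0 T, ENNReal.ofReal |f s - f t| ≤ ν (uIcc (x s) (x t))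

namespace IsHolderDominated

variable {T C a p : ℝ} {ν : Measure ℝ} {x f : ℝ → ℝ}

/-- A level at distance |y| is reached only by lags r ≥ (|y|/C)^(1/a), and the integral of r^(-1-p)
beyond that point is (C/|y|)^(p/a)/p. No lag below δ reaches a level farther away than Cδ^a. -/
theorem lintegral_indicator_rpow_le (h : IsHolderDominated T C a ν x f) (hp : 0 < p) (y : ℝ)
    {m δ : ℝ} (hm : m ≤ δ) :
    ∫⁻ r in Ioo 0 m, {r : ℝ | |y| ≤ C * r ^ a}.indicator
        (fun r => ENNReal.ofReal (r ^ (-1 - p))) r ≤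
      {y : ℝ | |y| ≤ C * δ ^ a}.indicator
        (fun y => ENNReal.ofReal (C ^ (p / a) / p) * ENNReal.ofReal |y| ^ (-(p / a))) y := by
  have hC := h.pos_C
  have ha := h.pos_a
  have hK : 0 < C ^ (p / a) / p := div_pos (Real.rpow_pos_of_pos hC _) hp
  by_cases hy : |y| ≤ C * δ ^ a
  · rw [indicator_of_mem (show y ∈ {y : ℝ | |y| ≤ C * δ ^ a} from hy)]
    rcases (abs_nonneg y).lt_or_eq with hy0 | hy0
    · set ρ := (|y| / C) ^ (1 / a) with hρ
      have hyC : 0 < |y| / C := div_pos hy0 hC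
      have hρ0 : 0 < ρ := Real.rpow_pos_of_pos hyC _
      have h1 : ∫⁻ r in Ioo 0 m, {r : ℝ | |y| ≤ C * r ^ a}.indicator
          (fun r => ENNReal.ofReal (r ^ (-1 - p))) r ≤
          ∫⁻ r in Ici ρ, ENNReal.ofReal (r ^ (-1 - p)) := by
        rw [← lintegral_indicator measurableSet_Ioo, ← lintegral_indicator measurableSet_Ici]
        refine lintegral_mono fun r => ?_
        by_cases hr : r ∈ Ioo 0 m
        · rw [indicator_of_mem hr]
          by_cases hr' : |y| ≤ C * r ^ a
          · rw [indicator_of_mem (show r ∈ {r : ℝ | |y| ≤ C * r ^ a} from hr')]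
            have : ρ ≤ r := by
              have h2 : |y| / C ≤ r ^ a := by rw [div_le_iff₀ hC]; linarith
              calc ρ ≤ (r ^ a) ^ (1 / a) := Real.rpow_le_rpow hyC.le h2 (by positivity)
                _ = r := by rw [← Real.rpow_mul hr.1.le, mul_one_div_cancel ha.ne', Real.rpow_one]
            rw [indicator_of_mem (show r ∈ Ici ρ from this)]
          · rw [indicator_of_notMem (show r ∉ {r : ℝ | |y| ≤ C * r ^ a} from hr')]
            exact zero_le
        · rw [indicator_of_notMem hr]; exact zero_le
      refine h1.trans (le_of_eq ?_)
      rw [setLIntegral_congr (Ioi_ae_eq_Ici (μ := volume) (a := ρ)).symm,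
        lintegral_Ioi_rpow hp hρ0, ENNReal.ofReal_rpow_of_pos hy0, ← ENNReal.ofReal_mul hK.le]
      congr 1
      rw [hρ, ← Real.rpow_mul hyC.le, Real.div_rpow hy0.le hC.le,
        show 1 / a * -p = -(p / a) by ring, Real.rpow_neg hC.le]
      field_simp
    -- At y = 0 the kernel on the right is 0 to a negative power, which is ∞.
    · rw [← hy0]
      have : -(p / a) < 0 := by
        have := div_pos hp ha
        linarith
      rw [ENNReal.ofReal_zero, ENNReal.zero_rpow_of_neg this,
        ENNReal.mul_top (by simpa using hK)]
      exact le_top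
  · rw [indicator_of_notMem (show y ∉ {y : ℝ | |y| ≤ C * δ ^ a} from hy)]
    refine le_of_eq ((setLIntegral_congr_fun measurableSet_Ioo fun r hr => ?_).trans lintegral_zero)
    have hr' : r ∉ {r : ℝ | |y| ≤ C * r ^ a} := fun hr' => hy (le_trans hr'
      (mul_le_mul_of_nonneg_left (Real.rpow_le_rpow hr.1.le (hr.2.le.trans hm) ha.le) hC.le))
    exact indicator_of_notMem hr' _

/-- Local part of the Marchaud kernel. -/
theorem lintegral_increment_le [SFinite ν] (h : IsHolderDominated T C a ν x f) (hp : 0 < p)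
    {s m δ : ℝ} (hs : s ∈ Icc 0 T) (hms : m ≤ s) (hm : m ≤ δ) :
    ∫⁻ r in Ioo 0 m, ENNReal.ofReal |f s - f (s - r)| * ENNReal.ofReal (r ^ (-1 - p)) ≤
      ENNReal.ofReal (C ^ (p / a) / p) * localPotential ν (p / a) (C * δ ^ a) (x s) := by
  have hmeas : Measurable fun z : ℝ × ℝ => {z : ℝ × ℝ | |x s - z.2| ≤ C * z.1 ^ a}.indicator
      (fun z => ENNReal.ofReal (z.1 ^ (-1 - p))) z :=
    Measurable.indicator (by fun_prop) (measurableSet_le (by fun_prop) (by fun_prop))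
  calc ∫⁻ r in Ioo 0 m, ENNReal.ofReal |f s - f (s - r)| * ENNReal.ofReal (r ^ (-1 - p))
      ≤ ∫⁻ r in Ioo 0 m, ∫⁻ b, {z : ℝ × ℝ | |x s - z.2| ≤ C * z.1 ^ a}.indicator
          (fun z => ENNReal.ofReal (z.1 ^ (-1 - p))) (r, b) ∂ν := by
        refine setLIntegral_mono' measurableSet_Ioo fun r hr => ?_
        have hsr : s - r ∈ Icc 0 T := ⟨by linarith [hr.2], by linarith [hr.1, hs.2]⟩
        have h1 : ENNReal.ofReal |f s - f (s - r)| ≤ ν {b | |x s - b| ≤ C * r ^ a} := by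
          refine (h.le s hs _ hsr).trans (measure_mono fun b hb => ?_)
          have h2 := h.holder s hs _ hsr
          rw [sub_sub_cancel, abs_of_pos hr.1] at h2
          refine le_trans ?_ h2
          exact abs_sub_left_of_mem_uIcc hb |> fun h3 => by
            rw [abs_sub_comm, abs_sub_comm (x s)]; exact h3
        have h3 : ∫⁻ b, {z : ℝ × ℝ | |x s - z.2| ≤ C * z.1 ^ a}.indicator
            (fun z => ENNReal.ofReal (z.1 ^ (-1 - p))) (r, b) ∂ν =
            ENNReal.ofReal (r ^ (-1 - p)) * ν {b | |x s - b| ≤ C * r ^ a} := by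
          rw [← lintegral_indicator_const (measurableSet_abs_sub_le _ _)]
          rfl
        rw [h3, mul_comm]
        gcongr
    _ = ∫⁻ b, (∫⁻ r in Ioo 0 m, {z : ℝ × ℝ | |x s - z.2| ≤ C * z.1 ^ a}.indicator
          (fun z => ENNReal.ofReal (z.1 ^ (-1 - p))) (r, b)) ∂ν :=
        lintegral_lintegral_swap hmeas.aemeasurable
    _ ≤ ∫⁻ b, {b | |x s - b| ≤ C * δ ^ a}.indicator (fun b =>
          ENNReal.ofReal (C ^ (p / a) / p) * ENNReal.ofReal |x s - b| ^ (-(p / a))) b ∂ν := by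
        refine lintegral_mono fun b => ?_
        have h1 := h.lintegral_indicator_rpow_le hp (x s - b) hm
        simp only [indicator, mem_ofPred_eq] at h1 ⊢
        exact h1
    _ = _ := by
        rw [lintegral_indicator (measurableSet_abs_sub_le _ _),
          lintegral_const_mul' _ _ ENNReal.ofReal_ne_top, localPotential]

/-- The levels which are close to the whole path on a cell. -/
theorem exists_oscillation_bound [SFinite ν] (h : IsHolderDominated T C a ν x f) (hp : 0 < p)
    {c d : ℝ} (hc : 0 ≤ c) (hcd : c < d) (hd : d ≤ T) :
    ∃ M : ℝ≥0∞, (∀ s ∈ Icc c d, ∀ t ∈ Icc c d, ENNReal.ofReal |f s - f t| ≤ M) ∧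
      M * ENNReal.ofReal ((d - c) ^ (1 - p)) ≤ ENNReal.ofReal (C ^ (p / a)) *
        ∫⁻ s in Ioc c d, localPotential ν (p / a) (C * (d - c) ^ a) (x s) := by
  have hC := h.pos_C
  have ha := h.pos_a
  have hδ : 0 < d - c := by linarith
  have hsub : ∀ s ∈ Icc c d, s ∈ Icc 0 T := fun s hs => ⟨hc.trans hs.1, hs.2.trans hd⟩
  set R := C * (d - c) ^ a with hR
  have hR0 : 0 < R := mul_pos hC (Real.rpow_pos_of_pos hδ _)
  have hosc : ∀ s ∈ Icc c d, ∀ t ∈ Icc c d, |x s - x t| ≤ R := fun s hs t ht => by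
    refine (h.holder s (hsub s hs) t (hsub t ht)).trans ?_
    have : |s - t| ≤ d - c := abs_sub_le_iff.2 ⟨by linarith [hs.2, ht.1], by linarith [ht.2, hs.1]⟩
    exact mul_le_mul_of_nonneg_left (Real.rpow_le_rpow (abs_nonneg _) this ha.le) hC.le
  -- This set contains every level between two values of the path on the cell, so its mass bounds
  -- the oscillation of f. Each of its levels also contributes at least R^(-p/a) to the potential at
  -- every time of the cell.
  set E : Set ℝ := {b | ∀ t ∈ Icc c d, |x t - b| ≤ R} with hE
  have hEm : MeasurableSet E := by
    have : IsClosed E := by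
      have : E = ⋂ t ∈ Icc c d, {b | |x t - b| ≤ R} := by ext; simp [hE]
      rw [this]
      exact isClosed_biInter fun t _ => isClosed_le (by fun_prop) continuous_const
    exact this.measurableSet
  refine ⟨ν E, fun s hs t ht => ?_, ?_⟩
  · refine (h.le s (hsub s hs) t (hsub t ht)).trans (measure_mono fun b hb u hu => ?_)
    have h1 := abs_sub_le_iff.1 (hosc u hu s hs)
    have h2 := abs_sub_le_iff.1 (hosc u hu t ht)
    rw [mem_uIcc] at hb
    rw [abs_sub_le_iff]
    rcases hb with hb | hb <;> constructor <;> linarith [hb.1, hb.2]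
  · have h1 : ∀ s ∈ Ioc c d, ENNReal.ofReal (R ^ (-(p / a))) * ν E ≤
        localPotential ν (p / a) R (x s) := fun s hs => by
      have hs' := Ioc_subset_Icc_self hs
      calc ENNReal.ofReal (R ^ (-(p / a))) * ν E
          = ∫⁻ _ in E, ENNReal.ofReal (R ^ (-(p / a))) ∂ν := by rw [setLIntegral_const]
        _ ≤ ∫⁻ b in E, ENNReal.ofReal |x s - b| ^ (-(p / a)) ∂ν := by
          refine setLIntegral_mono' hEm fun b hb => ?_
          rw [← ENNReal.ofReal_rpow_of_pos hR0, ENNReal.rpow_neg, ENNReal.rpow_neg]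
          refine ENNReal.inv_le_inv.2 (ENNReal.rpow_le_rpow
            (ENNReal.ofReal_le_ofReal (hb s hs')) (div_pos hp ha).le)
        _ ≤ _ := lintegral_mono_set fun b hb => hb s hs'
    have h2 : ENNReal.ofReal (R ^ (-(p / a))) * ν E * ENNReal.ofReal (d - c) ≤
        ∫⁻ s in Ioc c d, localPotential ν (p / a) R (x s) := by
      have := setLIntegral_mono' (μ := volume) measurableSet_Ioc h1
      rwa [setLIntegral_const, Real.volume_Ioc] at this
    refine le_trans (le_of_eq ?_) (mul_le_mul_right h2 _)
    rw [mul_comm (ENNReal.ofReal (R ^ _)), mul_assoc, mul_left_comm,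
      ← ENNReal.ofReal_mul (Real.rpow_nonneg hR0.le _),
      ← ENNReal.ofReal_mul (Real.rpow_nonneg hC.le _)]
    -- Since R = C (d-c)^a, the factor R^(-p/a) (d-c) is C^(-p/a) (d-c)^(1-p).
    congr 2
    rw [hR, Real.mul_rpow hC.le (Real.rpow_nonneg hδ.le _), ← Real.rpow_mul hδ.le,
      show a * -(p / a) = -p by field_simp, Real.rpow_neg hC.le, sub_eq_add_neg 1 p,
      Real.rpow_add hδ, Real.rpow_one]
    field_simp

end IsHolderDominated

theorem lintegral_Ioc_rpow_sub {p c d : ℝ} (hp : p < 1) (hcd : c < d) :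
    ∫⁻ s in Ioc c d, ENNReal.ofReal ((s - c) ^ (-p)) =
      ENNReal.ofReal ((d - c) ^ (1 - p) / (1 - p)) := by
  have h1 : IntervalIntegrable (fun s : ℝ => s ^ (-p)) volume 0 (d - c) :=
    intervalIntegral.intervalIntegrable_rpow' (by linarith)
  have h2 := h1.comp_sub_right c
  rw [zero_add, sub_add_cancel, intervalIntegrable_iff_integrableOn_Ioc_of_le hcd.le] at h2
  rw [← ofReal_integral_eq_lintegral_ofReal h2,
    ← intervalIntegral.integral_of_le hcd.le,
    intervalIntegral.integral_comp_sub_right (fun s : ℝ => s ^ (-p)), sub_self,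
    integral_rpow (Or.inl (by linarith))]
  · rw [show -p + 1 = 1 - p by ring, Real.zero_rpow (by linarith), sub_zero]
  · filter_upwards [ae_restrict_mem measurableSet_Ioc] with s hs
    exact Real.rpow_nonneg (by linarith [hs.1]) _

theorem lintegral_Ioo_sub_rpow {p c d : ℝ} (hp : p < 1) (hcd : c < d) :
    ∫⁻ s in Ioo c d, ENNReal.ofReal ((d - s) ^ (-p)) =
      ENNReal.ofReal ((d - c) ^ (1 - p) / (1 - p)) := by
  rw [← lintegral_Ioc_rpow_sub hp hcd,
    setLIntegral_congr (Ioo_ae_eq_Ioc (μ := volume) (a := c) (b := d)).symm,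
    ← lintegral_indicator measurableSet_Ioo, ← lintegral_indicator measurableSet_Ioo,
    ← lintegral_sub_left_eq_self _ (c + d)]
  congr 1 with s
  by_cases hs : s ∈ Ioo c d
  · rw [indicator_of_mem hs, indicator_of_mem (show c + d - s ∈ Ioo c d from
      ⟨by linarith [hs.2], by linarith [hs.1]⟩)]
    congr 2; ring
  · rw [indicator_of_notMem hs, indicator_of_notMem fun h : c + d - s ∈ Ioo c d => hs
      ⟨by linarith [h.2], by linarith [h.1]⟩]

namespace IsHolderDominated

variable {T C a p : ℝ} {ν : Measure ℝ} {x f : ℝ → ℝ}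

/-- The Marchaud norm of the deviation of `f` from one of its values on a cell. -/
theorem marchaudNorm_indicator_le [SFinite ν] (h : IsHolderDominated T C a ν x f) (hp : 0 < p)
    (hp1 : p < 1) {c d ξ : ℝ} (hc : 0 ≤ c) (hcd : c < d) (hd : d ≤ T) (hξ : ξ ∈ Icc c d) :
    marchaudNorm T p ((Ioc c d).indicator fun s => f s - f ξ) ≤
      (ENNReal.ofReal (C ^ (p / a) / p) +
        (ENNReal.ofReal (1 / (p * (1 - p))) + ENNReal.ofReal (1 / (p * (1 - p)))) *
          ENNReal.ofReal (C ^ (p / a))) *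
        ∫⁻ s in Ioc c d, localPotential ν (p / a) (C * (d - c) ^ a) (x s) := by
  obtain ⟨M, hM, hMle⟩ := h.exists_oscillation_bound hp hc hcd hd
  have hp1' : 0 < 1 - p := by linarith
  set V := localPotential ν (p / a) (C * (d - c) ^ a) with hV
  set K := ENNReal.ofReal (C ^ (p / a) / p) with hK
  set φ : ℝ → ℝ := (Ioc c d).indicator fun s => f s - f ξ with hφ
  set N : ℝ → ℝ≥0∞ := fun s => ∫⁻ r in Ioi (0 : ℝ), ‖(φ s - φ (s - r)) * r ^ (-1 - p)‖ₑ with hN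
  -- Both jumps of the deviation, at the two ends of the cell, cost M (d-c)^(1-p)/(p(1-p)); this is
  -- the combination that the oscillation bound controls.
  have hbound : ENNReal.ofReal (1 / p) * (M * ENNReal.ofReal ((d - c) ^ (1 - p) / (1 - p))) ≤
      ENNReal.ofReal (1 / (p * (1 - p))) *
        (ENNReal.ofReal (C ^ (p / a)) * ∫⁻ s in Ioc c d, V (x s)) := by
    refine le_trans (le_of_eq ?_) (mul_le_mul_right hMle _)
    rw [mul_left_comm, mul_left_comm (ENNReal.ofReal (1 / (p * (1 - p)))),
      ← ENNReal.ofReal_mul (by positivity), ← ENNReal.ofReal_mul (by positivity)]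
    congr 2
    field_simp
  have hleft : ∫⁻ s in Ioc 0 c, N s = 0 := by
    refine (setLIntegral_congr_fun measurableSet_Ioc fun s hs => ?_).trans lintegral_zero
    refine (setLIntegral_congr_fun measurableSet_Ioi fun r hr => ?_).trans lintegral_zero
    have hr : 0 < r := hr
    rw [hφ, indicator_of_notMem fun hs' => absurd hs'.1 (not_lt.2 hs.2),
      indicator_of_notMem fun hs' => absurd hs'.1 (by linarith [hs.2]), sub_zero, zero_mul,
      enorm_zero]
  have hmid : ∫⁻ s in Ioc c d, N s ≤ K * (∫⁻ s in Ioc c d, V (x s)) +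
      ENNReal.ofReal (1 / p) * (M * ENNReal.ofReal ((d - c) ^ (1 - p) / (1 - p))) := by
    -- Lags below s - c compare two points of the cell and give the local potential. Longer lags
    -- leave the cell, so the deviation is compared with 0.
    have h1 : ∀ s ∈ Ioc c d, N s ≤ K * V (x s) +
        ENNReal.ofReal (1 / p) * (M * ENNReal.ofReal ((s - c) ^ (-p))) := fun s hs => by
      have hsc : 0 < s - c := by linarith [hs.1]
      have hs' := Ioc_subset_Icc_self hs
      simp only [hN]
      rw [← Ioo_union_Ici_eq_Ioi hsc]
      refine (lintegral_union_le _ _ _).trans (add_le_add ?_ ?_)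
      · refine le_trans (le_of_eq ?_) (h.lintegral_increment_le hp (s := s) (m := s - c)
          (δ := d - c) ⟨hc.trans hs'.1, hs.2.trans hd⟩ (by linarith) (by linarith [hs.2]))
        refine setLIntegral_congr_fun measurableSet_Ioo fun r hr => ?_
        rw [hφ, indicator_of_mem hs, indicator_of_mem (show s - r ∈ Ioc c d from
          ⟨by linarith [hr.2], by linarith [hr.1, hs.2]⟩), sub_sub_sub_cancel_right,
          enorm_mul_rpow_eq_mul hr.1]
      · calc ∫⁻ r in Ici (s - c), ‖(φ s - φ (s - r)) * r ^ (-1 - p)‖ₑ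
            ≤ ∫⁻ r in Ici (s - c), M * ENNReal.ofReal (r ^ (-1 - p)) := by
              refine setLIntegral_mono' measurableSet_Ici fun r hr => ?_
              have hr : s - c ≤ r := hr
              rw [enorm_mul_rpow_eq_mul (hsc.trans_le hr), hφ, indicator_of_mem hs,
                indicator_of_notMem fun hs' => absurd hs'.1 (by linarith), sub_zero]
              gcongr
              exact hM s hs' ξ hξ
          _ = _ := by
              rw [lintegral_const_mul _ (by fun_prop),
                setLIntegral_congr (Ioi_ae_eq_Ici (μ := volume) (a := s - c)).symm,
                lintegral_Ioi_rpow hp hsc, mul_left_comm, ← ENNReal.ofReal_mul (by positivity)]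
              congr 2
              field_simp
    refine (setLIntegral_mono' measurableSet_Ioc h1).trans (le_of_eq ?_)
    rw [lintegral_add_right _ (by fun_prop), lintegral_const_mul' _ _ ENNReal.ofReal_ne_top,
      lintegral_const_mul _ (by fun_prop), lintegral_const_mul _ (by fun_prop),
      lintegral_Ioc_rpow_sub hp1 hcd]
  have hright : ∫⁻ s in Ioi d, N s ≤
      ENNReal.ofReal (1 / p) * (M * ENNReal.ofReal ((d - c) ^ (1 - p) / (1 - p))) := by
    -- Beyond the cell the deviation is 0, but the kernel still looks back into the cell; u = s - r
    -- is the point it sees.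
    have h1 : ∀ s ∈ Ioi d, N s ≤ ∫⁻ u in Ioo c d, M * ENNReal.ofReal ((s - u) ^ (-1 - p)) :=
      fun s hs => by
      have hs : d < s := hs
      rw [setLIntegral_congr (Ioo_ae_eq_Ioc (μ := volume) (a := c) (b := d)),
        ← lintegral_indicator measurableSet_Ioc, ← lintegral_sub_left_eq_self _ s]
      simp only [hN]
      rw [← lintegral_indicator measurableSet_Ioi]
      refine lintegral_mono fun r => ?_
      by_cases hr : r ∈ Ioi (0 : ℝ)
      · rw [indicator_of_mem hr, hφ, indicator_of_notMem fun hs' => absurd hs'.2 (not_le.2 hs),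
          zero_sub]
        by_cases hsr : s - r ∈ Ioc c d
        · rw [indicator_of_mem hsr, indicator_of_mem hsr, enorm_mul_rpow_eq_mul hr, abs_neg,
            sub_sub_cancel]
          gcongr
          exact hM _ (Ioc_subset_Icc_self hsr) ξ hξ
        · rw [indicator_of_notMem hsr, neg_zero, zero_mul, enorm_zero]
          exact zero_le
      · rw [indicator_of_notMem hr]
        exact zero_le
    refine (setLIntegral_mono' measurableSet_Ioi h1).trans (le_of_eq ?_)
    rw [lintegral_lintegral_swap (by fun_prop), ← lintegral_Ioo_sub_rpow hp1 hcd,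
      ← lintegral_const_mul _ (by fun_prop), ← lintegral_const_mul _ (by fun_prop)]
    refine setLIntegral_congr_fun measurableSet_Ioo fun u hu => ?_
    have hdu : 0 < d - u := by linarith [hu.2]
    have h2 : ∫⁻ s in Ioi d, ENNReal.ofReal ((s - u) ^ (-1 - p)) =
        ∫⁻ s in Ioi (d - u), ENNReal.ofReal (s ^ (-1 - p)) := by
      rw [← lintegral_indicator measurableSet_Ioi, ← lintegral_indicator measurableSet_Ioi,
        ← lintegral_sub_right_eq_self
          ((Ioi (d - u)).indicator fun s => ENNReal.ofReal (s ^ (-1 - p))) u]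
      congr 1 with s
      by_cases hs : d < s <;> simp [indicator, hs]
    rw [lintegral_const_mul _ (by fun_prop), h2, lintegral_Ioi_rpow hp hdu, mul_left_comm,
      ← ENNReal.ofReal_mul (by positivity)]
    congr 2
    field_simp
  have hcover : Ioc 0 T ⊆ Ioc 0 c ∪ (Ioc c d ∪ Ioi d) := fun s hs => by
    rcases le_or_gt s c with h1 | h1
    · exact Or.inl ⟨hs.1, h1⟩
    · rcases le_or_gt s d with h2 | h2
      · exact Or.inr (Or.inl ⟨h1, h2⟩)
      · exact Or.inr (Or.inr h2)
  calc marchaudNorm T p φ ≤ ∫⁻ s in Ioc 0 c ∪ (Ioc c d ∪ Ioi d), N s := lintegral_mono_set hcover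
    _ ≤ (∫⁻ s in Ioc 0 c, N s) + ((∫⁻ s in Ioc c d, N s) + ∫⁻ s in Ioi d, N s) :=
        (lintegral_union_le _ _ _).trans (add_le_add le_rfl (lintegral_union_le _ _ _))
    _ ≤ 0 + ((K * (∫⁻ s in Ioc c d, V (x s)) + ENNReal.ofReal (1 / (p * (1 - p))) *
        (ENNReal.ofReal (C ^ (p / a)) * ∫⁻ s in Ioc c d, V (x s))) +
        ENNReal.ofReal (1 / (p * (1 - p))) *
        (ENNReal.ofReal (C ^ (p / a)) * ∫⁻ s in Ioc c d, V (x s))) :=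
        add_le_add hleft.le (add_le_add (hmid.trans (add_le_add le_rfl hbound))
          (hright.trans hbound))
    _ = _ := by ring

end IsHolderDominated

theorem measurable_potential_kernel {x : ℝ → ℝ} (hx : Measurable x) (κ : ℝ) :
    Measurable fun z : ℝ × ℝ => ENNReal.ofReal |x z.1 - z.2| ^ (-κ) := by
  have h1 : Measurable fun z : ℝ × ℝ => |x z.1 - z.2| := by
    have : Measurable fun z : ℝ × ℝ => x z.1 - z.2 := by fun_prop
    exact measurable_abs.comp this
  exact h1.ennreal_ofReal.pow_const _

/-- Finite-energy paths: the energy of small balls tends to zero with the radius. -/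
theorem tendsto_lintegral_localPotential {T κ : ℝ} {ν : Measure ℝ} [SFinite ν] {x : ℝ → ℝ}
    (hx : Measurable x) (hκ : 0 < κ)
    (hE : ∫⁻ s in Ioc 0 T, ∫⁻ b, ENNReal.ofReal |x s - b| ^ (-κ) ∂ν < ∞) {ρ : ℕ → ℝ}
    (hρ : Tendsto ρ atTop (𝓝 0)) :
    Tendsto (fun n => ∫⁻ s in Ioc 0 T, localPotential ν κ (ρ n) (x s)) atTop (𝓝 0) := by
  set k : ℝ × ℝ → ℝ≥0∞ := fun z => ENNReal.ofReal |x z.1 - z.2| ^ (-κ) with hk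
  have hkm : Measurable k := measurable_potential_kernel hx κ
  have hm : ∀ r : ℝ, MeasurableSet {z : ℝ × ℝ | |x z.1 - z.2| ≤ r} := fun r => by
    have : Measurable fun z : ℝ × ℝ => x z.1 - z.2 := by fun_prop
    exact measurableSet_le (measurable_abs.comp this) measurable_const
  have hfin : ∫⁻ z, k z ∂((volume.restrict (Ioc 0 T)).prod ν) ≠ ∞ := by
    rw [lintegral_prod _ hkm.aemeasurable]
    exact hE.ne
  have h1 := tendsto_lintegral_of_dominated_convergence
    (μ := (volume.restrict (Ioc 0 T)).prod ν)
    (F := fun n z => {z : ℝ × ℝ | |x z.1 - z.2| ≤ ρ n}.indicator k z) (f := fun _ => 0) k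
    (fun n => hkm.indicator (hm _)) (fun n => ae_of_all _ fun z => indicator_le_self _ _ _) hfin ?_
  · rw [lintegral_zero] at h1
    refine h1.congr fun n => ?_
    rw [lintegral_prod _ (hkm.indicator (hm _)).aemeasurable]
    refine lintegral_congr fun s => ?_
    rw [localPotential, ← lintegral_indicator (measurableSet_abs_sub_le _ _)]
    rfl
  -- Finite energy excludes the diagonal almost everywhere, as the kernel is infinite there. Every
  -- other pair leaves the shrinking balls eventually.
  · filter_upwards [ae_lt_top hkm hfin] with z hz
    have hpos : 0 < |x z.1 - z.2| := by
      by_contra h0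
      have h0 : |x z.1 - z.2| = 0 := le_antisymm (not_lt.1 h0) (abs_nonneg _)
      simp only [hk] at hz
      rw [h0, ENNReal.ofReal_zero, ENNReal.zero_rpow_of_neg (by linarith)] at hz
      exact lt_irrefl _ hz
    refine tendsto_const_nhds.congr' ?_
    filter_upwards [hρ.eventually (gt_mem_nhds hpos)] with n hn
    have hz' : z ∉ {z : ℝ × ℝ | |x z.1 - z.2| ≤ ρ n} := fun h' => absurd hn (not_lt.2 h')
    exact (indicator_of_notMem hz' _).symm

namespace IsHolderDominated

variable {T C a p : ℝ} {ν : Measure ℝ} {x f g : ℝ → ℝ}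

theorem lintegral_localPotential_lt_top
    (hE : ∫⁻ s in Ioc 0 T, ∫⁻ b, ENNReal.ofReal |x s - b| ^ (-(p / a)) ∂ν < ∞) {c d ρ : ℝ}
    (hc : 0 ≤ c) (hd : d ≤ T) : ∫⁻ s in Ioc c d, localPotential ν (p / a) ρ (x s) < ∞ :=
  ((lintegral_mono_set (Ioc_subset_Ioc hc hd)).trans
    (lintegral_mono fun _ => setLIntegral_le_lintegral _ _)).trans_lt hE

theorem abs_sub_le [IsFiniteMeasure ν] (h : IsHolderDominated T C a ν x f) {s t : ℝ}
    (hs : s ∈ Icc 0 T) (ht : t ∈ Icc 0 T) : |f s - f t| ≤ (ν univ).toReal := by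
  rw [← ENNReal.ofReal_le_ofReal_iff ENNReal.toReal_nonneg,
    ENNReal.ofReal_toReal (measure_ne_top _ _)]
  exact (h.le s hs t ht).trans (measure_mono (subset_univ _))

/-- A uniform constant in the cell estimate. -/
theorem exists_marchaudNorm_le [SFinite ν] (h : IsHolderDominated T C a ν x f) (hp : 0 < p)
    (hp1 : p < 1) : ∃ K : ℝ≥0∞, K ≠ ∞ ∧ ∀ c d ξ : ℝ, 0 ≤ c → c < d → d ≤ T → ξ ∈ Icc c d →
      marchaudNorm T p ((Ioc c d).indicator fun s => f s - f ξ) ≤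
        K * ∫⁻ s in Ioc c d, localPotential ν (p / a) (C * (d - c) ^ a) (x s) :=
  ⟨_, ENNReal.add_ne_top.2 ⟨ENNReal.ofReal_ne_top, ENNReal.mul_ne_top
    (ENNReal.add_ne_top.2 ⟨ENNReal.ofReal_ne_top, ENNReal.ofReal_ne_top⟩) ENNReal.ofReal_ne_top⟩,
    fun _ _ _ h1 h2 h3 h4 => h.marchaudNorm_indicator_le hp hp1 h1 h2 h3 h4⟩

theorem isMarchaudLeft_indicator [IsFiniteMeasure ν] (h : IsHolderDominated T C a ν x f)
    (hp : 0 < p) (hp1 : p < 1)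
    (hE : ∫⁻ s in Ioc 0 T, ∫⁻ b, ENNReal.ofReal |x s - b| ^ (-(p / a)) ∂ν < ∞)
    {c d ξ : ℝ} (hc : 0 ≤ c) (hcd : c < d) (hd : d ≤ T) (hξ : ξ ∈ Icc c d) :
    IsMarchaudLeft T p ((Ioc c d).indicator fun s => f s - f ξ) := by
  have hsub : Ioc c d ⊆ Icc 0 T := (Ioc_subset_Ioc hc hd).trans Ioc_subset_Icc_self
  have hm : Measurable ((Ioc c d).indicator fun s => f s - f ξ) :=
    measurable_indicator_of_domRestrict measurableSet_Icc measurableSet_Ioc hsub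
      (h.measurable.sub_const (f ξ))
  obtain ⟨K, hK, hle⟩ := h.exists_marchaudNorm_le hp hp1
  refine isMarchaudLeft_of_marchaudNorm_lt_top hm ?_
    (fun s hs => indicator_of_notMem (fun h' => hs (Ioc_subset_Ioc hc hd h')) _)
    ((hle c d ξ hc hcd hd hξ).trans_lt
      (ENNReal.mul_lt_top hK.lt_top (lintegral_localPotential_lt_top hE hc hd)))
  rw [integrable_indicator_iff measurableSet_Ioc]
  refine IntegrableOn.of_bound (by simp)
    ((aemeasurable_indicator_iff measurableSet_Ioc).1 hm.aemeasurable).aestronglyMeasurable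
    (ν univ).toReal ?_
  filter_upwards [ae_restrict_mem measurableSet_Ioc] with s hs
  exact h.abs_sub_le (hsub hs) ⟨hc.trans hξ.1, hξ.2.trans hd⟩

/-- The weighted term is finite because f is bounded on [0, T] and p < 1. The increments are covered
by the cell estimate with the whole interval as one cell and tag 0, subtracting a constant being
harmless. -/
theorem memBesovTwo [IsFiniteMeasure ν] (h : IsHolderDominated T C a ν x f)
    (hp : 0 < p) (hp1 : p < 1)
    (hE : ∫⁻ s in Ioc 0 T, ∫⁻ b, ENNReal.ofReal |x s - b| ^ (-(p / a)) ∂ν < ∞) :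
    MemBesovTwo p T f := by
  have hT := h.pos_T
  have h0 : (0 : ℝ) ∈ Icc 0 T := ⟨le_rfl, hT.le⟩
  refine ⟨h.measurable, ENNReal.add_lt_top.2 ⟨?_, ?_⟩⟩
  · calc ∫⁻ s in Ioc 0 T, ENNReal.ofReal (|f s| / s ^ p)
        ≤ ∫⁻ s in Ioc 0 T, ENNReal.ofReal (|f 0| + (ν univ).toReal) *
            ENNReal.ofReal ((s - 0) ^ (-p)) := by
          refine setLIntegral_mono' measurableSet_Ioc fun s hs => ?_
          rw [← ENNReal.ofReal_mul (by positivity), sub_zero, Real.rpow_neg hs.1.le,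
            ← div_eq_mul_inv]
          have h1 := h.abs_sub_le (Ioc_subset_Icc_self hs) h0
          have h2 := abs_sub_abs_le_abs_sub (f s) (f 0)
          have h3 : |f s| ≤ |f 0| + (ν univ).toReal := by linarith
          exact ENNReal.ofReal_le_ofReal
            (div_le_div_of_nonneg_right h3 (Real.rpow_nonneg hs.1.le _))
      _ < ∞ := by
          rw [lintegral_const_mul' _ _ ENNReal.ofReal_ne_top, lintegral_Ioc_rpow_sub hp1 hT]
          exact ENNReal.mul_lt_top ENNReal.ofReal_lt_top ENNReal.ofReal_lt_top
  · obtain ⟨K, hK, hle⟩ := h.exists_marchaudNorm_le hp hp1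
    refine lt_of_le_of_lt ?_ ((hle 0 T 0 le_rfl hT le_rfl h0).trans_lt
      (ENNReal.mul_lt_top hK.lt_top (lintegral_localPotential_lt_top hE le_rfl le_rfl)))
    refine setLIntegral_mono' measurableSet_Ioc fun s hs => ?_
    have h1 := lintegral_left_kernel_eq (f := fun s => f s - f 0) hp hs
    simp only [sub_sub_sub_cancel_right] at h1
    rw [h1]
    exact le_self_add

/-- The pathwise theorem: existence of the integral and convergence of Riemann–Stieltjes sums. -/
theorem exists_hasGLSIntegral [IsFiniteMeasure ν] (h : IsHolderDominated T C a ν x f)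
    (hx : Measurable x) (hp : 0 < p) (hp1 : p < 1)
    (hE : ∫⁻ s in Ioc 0 T, ∫⁻ b, ENNReal.ofReal |x s - b| ^ (-(p / a)) ∂ν < ∞)
    (hg : MemBesovOne (1 - p) T g) (π : ℕ → TaggedPartition T)
    (hπ : Tendsto (fun n => (π n).mesh) atTop (𝓝 0)) :
    ∃ I : ℝ, HasGLSIntegral T f g I ∧ Tendsto (fun n => (π n).rsSum f g) atTop (𝓝 I) := by
  have hT := h.pos_T
  have ha := h.pos_a
  have hadm : GLSAdmissible p T f g := ⟨hp, hp1, h.memBesovTwo hp hp1 hE, hg⟩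
  refine ⟨∫ s in (0 : ℝ)..T, glsIntegrand p T f g s, ⟨⟨p, hadm⟩, fun q hq =>
    ⟨hq.intervalIntegrable hT, tendsto_nhds_unique (hq.tendsto_forwardIntegral hT)
      (hadm.tendsto_forwardIntegral hT)⟩⟩, ?_⟩
  obtain ⟨K, hK, hle⟩ := h.exists_marchaudNorm_le hp hp1
  obtain ⟨K', hK', hle'⟩ := TaggedPartition.exists_abs_integral_sub_rsSum_le hT hadm
  set I := ∫ s in (0 : ℝ)..T, glsIntegrand p T f g s with hI
  have htag : ∀ n i, (π n).tag i ∈ Icc ((π n).pt i.castSucc) ((π n).pt i.succ) :=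
    fun n i => (π n).tag_mem i
  have hdev : ∀ n i, IsMarchaudLeft T p ((π n).deviation f i) := fun n i =>
    h.isMarchaudLeft_indicator hp hp1 hE ((π n).pt_nonneg _) ((π n).pt_lt i) ((π n).pt_le _)
      (htag n i)
  -- Enlarging each ball to the radius given by the mesh lets the cell bounds add up to one integral
  -- over (0, T].
  have hbound : ∀ n, ENNReal.ofReal |(π n).rsSum f g - I| ≤
      K' * K * ∫⁻ s in Ioc 0 T, localPotential ν (p / a) (C * (π n).mesh ^ a) (x s) := fun n => by
    refine (hle' (π n) (hdev n)).trans ?_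
    rw [mul_assoc]
    gcongr
    refine le_trans (Finset.sum_le_sum fun i _ => ?_)
      ((Finset.mul_sum _ _ _).symm.trans_le (mul_le_mul_right ((π n).sum_lintegral_cell_le _) K))
    refine (hle _ _ _ ((π n).pt_nonneg _) ((π n).pt_lt i) ((π n).pt_le _) (htag n i)).trans ?_
    refine mul_le_mul_right (lintegral_mono fun s => localPotential_mono _ _ _ ?_) K
    exact mul_le_mul_of_nonneg_left (Real.rpow_le_rpow (sub_nonneg.2 ((π n).pt_lt i).le)
      ((π n).sub_le_mesh i) ha.le) h.pos_C.le
  have hρ : Tendsto (fun n => C * (π n).mesh ^ a) atTop (𝓝 0) := by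
    have := (hπ.rpow_const (p := a) (Or.inr ha.le)).const_mul C
    rwa [Real.zero_rpow ha.ne', mul_zero] at this
  have hlim := ENNReal.Tendsto.const_mul (a := K' * K)
    (tendsto_lintegral_localPotential hx (div_pos hp ha) hE hρ)
    (Or.inr (ENNReal.mul_ne_top hK' hK))
  rw [mul_zero] at hlim
  have h0 := tendsto_of_tendsto_of_tendsto_of_le_of_le tendsto_const_nhds hlim
    (fun _ => zero_le) hbound
  rw [tendsto_iff_norm_sub_tendsto_zero]
  have h1 := (ENNReal.tendsto_toReal ENNReal.zero_ne_top).comp h0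
  refine h1.congr fun n => ?_
  simp

end IsHolderDominated

/-- The surplus γ - p > 0 in the exponent makes the singular integral converge and both terms
bounded by powers of T. -/
theorem memBesovOne_of_holder {T C γ p : ℝ} {g : ℝ → ℝ} (hC : 0 ≤ C)
    (hpγ : p < γ) (hg : ∀ s ∈ Icc 0 T, ∀ t ∈ Icc 0 T, |g t - g s| ≤ C * |t - s| ^ γ)
    (hm : Measurable ((Icc 0 T).domRestrict g)) : MemBesovOne p T g := by
  refine ⟨hm, ?_⟩
  have hγp : 0 < γ - p := by linarith
  refine lt_of_le_of_lt (b := ENNReal.ofReal (C * T ^ (γ - p)) +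
    ENNReal.ofReal C * ENNReal.ofReal (T ^ (γ - p) / (γ - p))) ?_
    (ENNReal.add_lt_top.2 ⟨ENNReal.ofReal_lt_top,
      ENNReal.mul_lt_top ENNReal.ofReal_lt_top ENNReal.ofReal_lt_top⟩)
  refine iSup_le fun s => iSup_le fun t => iSup_le fun ⟨h0, hst, htT⟩ => ?_
  have hsub : ∀ u, s ≤ u → u ≤ t → u ∈ Icc 0 T := fun u h1 h2 => ⟨h0.trans h1, h2.trans htT⟩
  have hs := hsub s le_rfl hst.le
  have hts : 0 < t - s := by linarith
  have hpow : (t - s) ^ (γ - p) ≤ T ^ (γ - p) :=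
    Real.rpow_le_rpow hts.le (by linarith) hγp.le
  refine add_le_add (ENNReal.ofReal_le_ofReal ?_) ?_
  · rw [div_le_iff₀ (Real.rpow_pos_of_pos hts _)]
    have h1 := hg s hs t (hsub t hst.le le_rfl)
    rw [abs_of_pos hts] at h1
    calc |g t - g s| ≤ C * (t - s) ^ γ := h1
      _ = C * (t - s) ^ (γ - p) * (t - s) ^ p := by
        rw [mul_assoc, ← Real.rpow_add hts, sub_add_cancel]
      _ ≤ C * T ^ (γ - p) * (t - s) ^ p := by gcongr
  · calc ∫⁻ u in Ioc s t, ENNReal.ofReal (|g u - g s| / (u - s) ^ (1 + p))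
        ≤ ∫⁻ u in Ioc s t, ENNReal.ofReal C * ENNReal.ofReal ((u - s) ^ (-(1 - (γ - p)))) := by
          refine setLIntegral_mono' measurableSet_Ioc fun u hu => ?_
          have hus : 0 < u - s := by linarith [hu.1]
          have h1 := hg s hs u (hsub u hu.1.le hu.2)
          rw [abs_of_pos hus] at h1
          rw [← ENNReal.ofReal_mul hC]
          refine ENNReal.ofReal_le_ofReal ?_
          rw [div_le_iff₀ (Real.rpow_pos_of_pos hus _), mul_assoc, ← Real.rpow_add hus,
            show -(1 - (γ - p)) + (1 + p) = γ by ring]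
          exact h1
      _ = ENNReal.ofReal C * ENNReal.ofReal ((t - s) ^ (γ - p) / (γ - p)) := by
          rw [lintegral_const_mul' _ _ ENNReal.ofReal_ne_top,
            lintegral_Ioc_rpow_sub (by linarith) hst, sub_sub_cancel]
      _ ≤ _ := by gcongr

theorem HolderOnWith.abs_sub_le {C r : ℝ≥0} {f : ℝ → ℝ} {s : Set ℝ} (hf : HolderOnWith C r f s)
    {x y : ℝ} (hx : x ∈ s) (hy : y ∈ s) : |f x - f y| ≤ C * |x - y| ^ (r : ℝ) := by
  have h := hf.edist_le hx hy
  rw [edist_dist, edist_dist, Real.dist_eq, Real.dist_eq,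
    ENNReal.ofReal_rpow_of_nonneg (abs_nonneg _) r.coe_nonneg, ← ENNReal.ofReal_coe_nnreal,
    ← ENNReal.ofReal_mul C.coe_nonneg, ENNReal.ofReal_le_ofReal_iff (by positivity)] at h
  exact h

/-! ### Measurable modifications and finite energy of random paths -/

section Modification

variable {Ω : Type*} [MeasurableSpace Ω] {P : Measure Ω} {T : ℝ} {α : ℝ≥0} {X : ℝ → Ω → ℝ}

/-- A Hölder process has a jointly measurable modification with continuous paths. -/
theorem IsHolderProcess.exists_continuous_modification (hT : 0 < T) (hα : 0 < α)
    (hX : IsHolderProcess P T α X) :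
    ∃ X' : ℝ → Ω → ℝ, Measurable (Function.uncurry X') ∧ (∀ ω, Continuous fun t => X' t ω) ∧
      ∀ᵐ ω ∂P, ∀ t ∈ Icc 0 T, X' t ω = X t ω := by
  -- Clamping time to [0, T] keeps paths continuous on the whole line, where nothing is assumed
  -- about X outside the interval.
  set pr : ℝ → ℝ := fun t => (projIcc 0 T hT.le t : ℝ) with hpr
  have hprm : ∀ t, pr t ∈ Icc 0 T := fun t => (projIcc 0 T hT.le t).2
  have hprc : Continuous pr := continuous_subtype_val.comp continuous_projIcc
  -- Only countably many exceptional sets can be discarded, so measurable versions are fixed at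
  -- rational times; other times follow by continuity.
  have hW : ∀ q : ℚ, ∀ᵐ ω ∂P, X (pr q) ω = (hX.1 _ (hprm q)).mk _ ω :=
    fun q => (hX.1 _ (hprm q)).ae_eq_mk
  obtain ⟨S, hSae, hSm, hS⟩ := (hX.2.and (ae_all_iff.2 hW)).exists_measurable_mem
  set X' : ℝ → Ω → ℝ := fun t => S.indicator (X (pr t)) with hX'
  have hcont : ∀ ω, Continuous fun t => X' t ω := fun ω => by
    by_cases hω : ω ∈ S
    · obtain ⟨C, hC⟩ := (hS ω hω).1
      have h1 : ContinuousOn (fun t => X t ω) (Icc 0 T) := (hC.uniformContinuousOn hα).continuousOn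
      have h2 : Continuous fun t => X (pr t) ω := h1.comp_continuous hprc hprm
      simpa [hX', hω] using h2
    · simpa [hX', hω] using continuous_const
  refine ⟨X', measurable_uncurry_of_continuous_of_measurable hcont fun t => ?_, hcont, ?_⟩
  · obtain ⟨u, hu, hut⟩ := mem_closure_iff_seq_limit.1 (Rat.denseRange_cast (𝕜 := ℝ) t)
    choose q hq using hu
    refine measurable_of_tendsto_metrizable (f := fun n => X' (u n)) (fun n => ?_) ?_
    · have : X' (u n) = S.indicator ((hX.1 _ (hprm (q n))).mk _) := by
        ext ω
        by_cases hω : ω ∈ S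
        · simp only [hX', hω, indicator_of_mem, ← hq n]
          exact (hS ω hω).2 (q n)
        · simp [hX', hω]
      rw [this]
      exact (hX.1 _ (hprm (q n))).measurable_mk.indicator hSm
    · exact tendsto_pi_nhds.2 fun ω => ((hcont ω).tendsto t).comp hut
  · filter_upwards [hSae] with ω hω t ht
    simp only [hX', hω, indicator_of_mem, hpr]
    rw [projIcc_of_mem hT.le ht]

/-- The integral of the Riesz kernel over the unit ball. -/
theorem lintegral_Icc_abs_rpow_lt_top {κ : ℝ} (hκ : κ < 1) :
    ∫⁻ y in Icc (-1 : ℝ) 1, ENNReal.ofReal |y| ^ (-κ) < ∞ := by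
  have hcover : Icc (-1 : ℝ) 1 ⊆ {-1} ∪ ({0} ∪ (Ioo (-1) 0 ∪ Ioc 0 1)) := fun y hy => by
    rcases hy.1.eq_or_lt with h | h
    · exact Or.inl h.symm
    · rcases lt_trichotomy y 0 with h0 | h0 | h0
      · exact Or.inr (Or.inr (Or.inl ⟨h, h0⟩))
      · exact Or.inr (Or.inl h0)
      · exact Or.inr (Or.inr (Or.inr ⟨h0, hy.2⟩))
  have e1 : ∫⁻ y in Ioo (-1 : ℝ) 0, ENNReal.ofReal |y| ^ (-κ) < ∞ := by
    have : ∀ y ∈ Ioo (-1 : ℝ) 0, ENNReal.ofReal |y| ^ (-κ) = ENNReal.ofReal ((0 - y) ^ (-κ)) :=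
      fun y hy => by
      rw [abs_of_neg hy.2, zero_sub, ENNReal.ofReal_rpow_of_pos (by linarith [hy.2])]
    rw [setLIntegral_congr_fun measurableSet_Ioo this, lintegral_Ioo_sub_rpow hκ (by norm_num)]
    exact ENNReal.ofReal_lt_top
  have e2 : ∫⁻ y in Ioc (0 : ℝ) 1, ENNReal.ofReal |y| ^ (-κ) < ∞ := by
    have : ∀ y ∈ Ioc (0 : ℝ) 1, ENNReal.ofReal |y| ^ (-κ) = ENNReal.ofReal ((y - 0) ^ (-κ)) :=
      fun y hy => by
      rw [abs_of_pos hy.1, sub_zero, ENNReal.ofReal_rpow_of_pos hy.1]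
    rw [setLIntegral_congr_fun measurableSet_Ioc this, lintegral_Ioc_rpow_sub hκ (by norm_num)]
    exact ENNReal.ofReal_lt_top
  refine ((lintegral_mono_set hcover).trans ((lintegral_union_le _ _ _).trans
    (add_le_add le_rfl ((lintegral_union_le _ _ _).trans
      (add_le_add le_rfl (lintegral_union_le _ _ _)))))).trans_lt ?_
  rw [setLIntegral_measure_zero _ _ Real.volume_singleton,
    setLIntegral_measure_zero _ _ Real.volume_singleton, zero_add, zero_add]
  exact ENNReal.add_lt_top.2 ⟨e1, e2⟩

/-- Negative moments of a variable with bounded density. -/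
theorem lintegral_abs_sub_rpow_le [IsProbabilityMeasure P] {U : Ω → ℝ} {c : ℝ≥0∞} {κ : ℝ}
    (hκ : 0 < κ) [HasPDF U P volume] (hU : ∀ᵐ y : ℝ, pdf U P volume y ≤ c) (b : ℝ) :
    ∫⁻ ω, ENNReal.ofReal |U ω - b| ^ (-κ) ∂P ≤
      1 + c * ∫⁻ y in Icc (-1 : ℝ) 1, ENNReal.ofReal |y| ^ (-κ) := by
  have hm : Measurable fun y : ℝ => ENNReal.ofReal |y - b| ^ (-κ) := by
    have h1 : Measurable fun y : ℝ => |y - b| := measurable_abs.comp (measurable_sub_const b)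
    exact h1.ennreal_ofReal.pow_const _
  set G : ℝ → ℝ≥0∞ := (Icc (-1 : ℝ) 1).indicator fun y => ENNReal.ofReal |y| ^ (-κ) with hG
  have hGm : Measurable G := by
    refine Measurable.indicator ?_ measurableSet_Icc
    exact measurable_abs.ennreal_ofReal.pow_const _
  rw [← pdf.lintegral_pdf_mul (X := U) (μ := volume) hm.aemeasurable]
  calc ∫⁻ y, pdf U P volume y * ENNReal.ofReal |y - b| ^ (-κ)
      ≤ ∫⁻ y, (pdf U P volume y + c * G (y - b)) := by
        refine lintegral_mono_ae ?_
        filter_upwards [hU] with y hy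
        by_cases h : y - b ∈ Icc (-1 : ℝ) 1
        · rw [hG, indicator_of_mem h]
          exact (mul_le_mul' hy le_rfl).trans le_add_self
        · have h1 : 1 ≤ |y - b| := by
            by_contra h'
            exact h (abs_le.1 (not_le.1 h').le)
          have h2 : ENNReal.ofReal |y - b| ^ (-κ) ≤ 1 := by
            rw [ENNReal.rpow_neg]
            refine ENNReal.inv_le_one.2 (ENNReal.one_le_rpow ?_ hκ)
            rwa [ENNReal.one_le_ofReal]
          exact (mul_le_of_le_one_right' h2).trans le_self_add
    _ = 1 + c * ∫⁻ y in Icc (-1 : ℝ) 1, ENNReal.ofReal |y| ^ (-κ) := by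
        rw [lintegral_add_left (measurable_pdf U P volume),
          lintegral_const_mul c (f := fun y => G (y - b)) (hGm.comp (measurable_sub_const b)),
          lintegral_sub_right_eq_self G b, hG, lintegral_indicator measurableSet_Icc,
          pdf.lintegral_eq_measure_univ, measure_univ]

/-- Almost all paths of a process with integrably bounded densities have finite energy with
respect to a finite measure. -/
theorem HasIntegrablyBoundedDensity.ae_energy_lt_top [IsProbabilityMeasure P]
    (hX : HasIntegrablyBoundedDensity P T X) {X' : ℝ → Ω → ℝ}
    (hX'm : Measurable (Function.uncurry X')) (hXX' : ∀ᵐ ω ∂P, ∀ t ∈ Icc 0 T, X' t ω = X t ω)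
    (ν : Measure ℝ) [IsFiniteMeasure ν] {κ : ℝ} (hκ : 0 < κ) (hκ1 : κ < 1) :
    ∀ᵐ ω ∂P, ∫⁻ s in Ioc 0 T, ∫⁻ b, ENNReal.ofReal |X' s ω - b| ^ (-κ) ∂ν < ∞ := by
  obtain ⟨h, hh, hpdf⟩ := hX
  have hk : Measurable fun z : Ω × ℝ × ℝ => ENNReal.ofReal |X' z.2.1 z.1 - z.2.2| ^ (-κ) := by
    have h1 : Measurable fun z : Ω × ℝ × ℝ => X' z.2.1 z.1 :=
      hX'm.comp (f := fun z : Ω × ℝ × ℝ => (z.2.1, z.1)) (by fun_prop)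
    have h2 : Measurable fun z : Ω × ℝ × ℝ => X' z.2.1 z.1 - z.2.2 :=
      h1.sub (by fun_prop)
    exact (measurable_abs.comp h2).ennreal_ofReal.pow_const _
  set J := ∫⁻ y in Icc (-1 : ℝ) 1, ENNReal.ofReal |y| ^ (-κ) with hJ
  have hJtop : J < ∞ := lintegral_Icc_abs_rpow_lt_top hκ1
  have e : ∀ ω, ∫⁻ s in Ioc 0 T, ∫⁻ b, ENNReal.ofReal |X' s ω - b| ^ (-κ) ∂ν =
      ∫⁻ z, ENNReal.ofReal |X' z.1 ω - z.2| ^ (-κ) ∂((volume.restrict (Ioc 0 T)).prod ν) :=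
    fun ω => (lintegral_prod (fun z : ℝ × ℝ => ENNReal.ofReal |X' z.1 ω - z.2| ^ (-κ))
      (hk.comp measurable_prodMk_left).aemeasurable).symm
  have hle : ∀ᵐ s ∂(volume.restrict (Ioc 0 T)), ∀ b,
      ∫⁻ ω, ENNReal.ofReal |X' s ω - b| ^ (-κ) ∂P ≤ 1 + ENNReal.ofReal (h s) * J := by
    filter_upwards [ae_restrict_of_ae_restrict_of_subset Ioc_subset_Icc_self hpdf,
      ae_restrict_mem measurableSet_Ioc] with s hs hsm b
    have heq : X s =ᵐ[P] X' s :=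
      hXX'.mono fun ω hω => (hω s (Ioc_subset_Icc_self hsm)).symm
    have := hs.1
    have := HasPDF.congr heq (μ := volume)
    refine lintegral_abs_sub_rpow_le hκ ?_ b
    rw [← pdf.congr heq]
    exact hs.2
  -- By Tonelli the expectation is taken first, for fixed s and b. Its bound is uniform in b and
  -- integrable in s.
  have hfin : ∫⁻ ω, (∫⁻ s in Ioc 0 T, ∫⁻ b, ENNReal.ofReal |X' s ω - b| ^ (-κ) ∂ν) ∂P < ∞ := by
    simp only [e]
    rw [lintegral_lintegral_swap hk.aemeasurable, lintegral_prod _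
      (hk.lintegral_prod_left').aemeasurable]
    calc ∫⁻ s in Ioc 0 T, ∫⁻ b, (∫⁻ ω, ENNReal.ofReal |X' s ω - b| ^ (-κ) ∂P) ∂ν
        ≤ ∫⁻ s in Ioc 0 T, (1 + ENNReal.ofReal (h s) * J) * ν univ := by
          refine lintegral_mono_ae (hle.mono fun s hs => ?_)
          exact (lintegral_mono hs).trans_eq (lintegral_const _)
      _ < ∞ := by
          rw [lintegral_mul_const' _ _ (measure_ne_top _ _)]
          refine ENNReal.mul_lt_top ?_ (measure_lt_top _ _)
          rw [lintegral_add_left measurable_const, lintegral_mul_const' _ _ hJtop.ne]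
          refine ENNReal.add_lt_top.2 ⟨by simp, ENNReal.mul_lt_top ?_ hJtop⟩
          exact (hh.mono_set Ioc_subset_Icc_self).lintegral_lt_top
  refine ae_lt_top ?_ hfin.ne
  simp only [e]
  exact hk.lintegral_prod_right'

end Modification

/-! ### Functions of bounded variation and the conclusion -/

/-- A function of locally bounded variation is measurable, with increments dominated by a locally
finite measure. -/
theorem LocallyBoundedVariationOn.exists_measure {g : ℝ → ℝ}
    (hg : LocallyBoundedVariationOn g univ) :
    Measurable g ∧ ∃ μ : Measure ℝ, IsLocallyFiniteMeasure μ ∧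
      ∀ x y, ENNReal.ofReal |g x - g y| ≤ μ (uIcc x y) := by
  obtain ⟨p, q, hp, hq, rfl⟩ := hg.exists_monotoneOn_sub_monotoneOn
  rw [monotoneOn_univ] at hp hq
  -- Here g = p - q, and the measure is that of p + q, which dominates the increments of both
  -- monotone parts.
  refine ⟨hp.measurable.sub hq.measurable, (hp.add hq).stieltjesFunction.measure,
    inferInstance, fun x y => ?_⟩
  wlog hxy : x ≤ y generalizing x y
  · rw [abs_sub_comm, uIcc_comm]
    exact this y x (le_of_not_ge hxy)
  rw [uIcc_of_le hxy, StieltjesFunction.measure_Icc]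
  refine ENNReal.ofReal_le_ofReal ?_
  -- The mass of a closed interval runs from the left limit at x to the right limit at y, so it
  -- dominates the increment whatever values are taken at jumps.
  have h1 : (p + q) y ≤ (hp.add hq).stieltjesFunction y := (hp.add hq).le_rightLim le_rfl
  have h2 : Function.leftLim (hp.add hq).stieltjesFunction x ≤ (p + q) x := by
    refine le_of_tendsto ((hp.add hq).stieltjesFunction.mono.tendsto_leftLim x) ?_
    filter_upwards [self_mem_nhdsWithin] with z hz
    exact (hp.add hq).rightLim_le hz
  have h3 := hp hxy
  have h4 := hq hxy
  simp only [Pi.add_apply, Pi.sub_apply] at h1 h2 ⊢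
  rw [abs_le]
  constructor <;> linarith

theorem theorem4p1 {Ω : Type*} [MeasurableSpace Ω] (P : Measure Ω) [IsProbabilityMeasure P]
    (T : ℝ) (hT : 0 < T) (α γ : ℝ≥0) (hα : 0 < α) (hγ : 0 < γ) (hαγ : 1 < α + γ)
    (Z Y : ℝ → Ω → ℝ) (hZ : MemBViC P T α Z) (hY : IsHolderProcess P T γ Y)
    (π : ℕ → TaggedPartition T) (hπ : Tendsto (fun n => (π n).mesh) atTop (𝓝 0)) :
    ∀ᵐ ω ∂P, ∃ I : ℝ,
      HasGLSIntegral T (fun t => Z t ω) (fun t => Y t ω) I ∧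
        Tendsto (fun n => (π n).rsSum (fun t => Z t ω) (fun t => Y t ω)) atTop (𝓝 I) := by
  obtain ⟨g, X, hg, hX, hdens, hZX⟩ := hZ
  obtain ⟨hgm, μ, hμ, hgμ⟩ := hg.exists_measure
  obtain ⟨X', hX'm, hX'c, hX'X⟩ := hX.exists_continuous_modification hT hα
  have hα' : (0 : ℝ) < α := hα
  have hγ' : (0 : ℝ) < γ := hγ
  have hαγ' : (1 : ℝ) < α + γ := by exact_mod_cast hαγ
  -- The bound p > 1 - γ puts Y in W₁^(1-p), and p < α makes the kernel exponent p/α less than 1.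
  -- The two are compatible because α + γ > 1.
  obtain ⟨p, hpl, hpu⟩ : ∃ p : ℝ, max 0 (1 - (γ : ℝ)) < p ∧ p < min 1 (α : ℝ) :=
    exists_between (max_lt (lt_min one_pos hα') (lt_min (by linarith) (by linarith)))
  obtain ⟨hp0, hpγ⟩ := max_lt_iff.1 hpl
  obtain ⟨hp1, hpα⟩ := lt_min_iff.1 hpu
  have hκ : 0 < p / α := div_pos hp0 hα'
  have hκ1 : p / α < 1 := (div_lt_one hα').2 hpα
  -- The measure is only locally finite and the range of the path is random. The energy is therefore
  -- shown finite for all the restrictions at once, and N is chosen afterwards from the path.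
  have hE : ∀ᵐ ω ∂P, ∀ N : ℕ, ∫⁻ s in Ioc 0 T, ∫⁻ b, ENNReal.ofReal |X' s ω - b| ^ (-(p / α))
      ∂(μ.restrict (Icc (-(N : ℝ)) N)) < ∞ := by
    refine ae_all_iff.2 fun N => ?_
    have : IsFiniteMeasure (μ.restrict (Icc (-(N : ℝ)) N)) :=
      ⟨by rw [Measure.restrict_apply_univ]; exact isCompact_Icc.measure_lt_top⟩
    exact hdens.ae_energy_lt_top hX'm hX'X _ hκ hκ1
  filter_upwards [hE, hX'X, hX.2, hY.2, hZX] with ω hEω hXω hHX hHY hZω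
  obtain ⟨CX, hCX⟩ := hHX
  obtain ⟨CY, hCY⟩ := hHY
  obtain ⟨R, hR⟩ := (isCompact_Icc (a := (0 : ℝ)) (b := T)).exists_bound_of_continuousOn
    (hX'c ω).continuousOn
  obtain ⟨N, hN⟩ := exists_nat_ge R
  have hrange : ∀ t ∈ Icc 0 T, X' t ω ∈ Icc (-(N : ℝ)) N := fun t ht =>
    abs_le.1 ((hR t ht).trans hN)
  have : IsFiniteMeasure (μ.restrict (Icc (-(N : ℝ)) N)) :=
    ⟨by rw [Measure.restrict_apply_univ]; exact isCompact_Icc.measure_lt_top⟩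
  have hZ' : ∀ t ∈ Icc 0 T, Z t ω = g (X' t ω) := fun t ht => by rw [hZω t ht, hXω t ht]
  -- Adding 1 makes the Hölder constant strictly positive, even for a constant path.
  have hdom : IsHolderDominated T (CX + 1) α (μ.restrict (Icc (-(N : ℝ)) N))
      (fun t => X' t ω) (fun t => Z t ω) := by
    refine ⟨hT, by positivity, hα', fun s hs t ht => ?_, ?_, fun s hs t ht => ?_⟩
    · rw [hXω s hs, hXω t ht]
      refine (hCX.abs_sub_le hs ht).trans ?_
      exact mul_le_mul_of_nonneg_right (by linarith) (Real.rpow_nonneg (abs_nonneg _) _)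
    · have : (Icc 0 T).domRestrict (fun t => Z t ω) =
          (Icc 0 T).domRestrict (fun t => g (X' t ω)) := by
        ext t
        exact hZ' t t.2
      rw [this]
      exact (hgm.comp (hX'c ω).measurable).comp measurable_subtype_coe
    · rw [hZ' s hs, hZ' t ht, Measure.restrict_apply measurableSet_uIcc,
        inter_eq_left.2 (ordConnected_Icc.uIcc_subset (hrange s hs) (hrange t ht))]
      exact hgμ _ _
  refine hdom.exists_hasGLSIntegral (hX'c ω).measurable hp0 hp1 (hEω N) ?_ π hπ
  refine memBesovOne_of_holder (γ := γ) (C := CY) CY.2 (by linarith)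
    (fun s hs t ht => hCY.abs_sub_le ht hs) ?_
  exact (continuousOn_iff_continuous_domRestrict.1
    (hCY.uniformContinuousOn hγ).continuousOn).measurable
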